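/- Let $n\le 4$ and let $B_n$ be the braid group on $n$ strands, with Artin generators $\sigma_1,\dots,\sigma_{n-1}$ and band generators $$a_{ij}=(\sigma_{j-1}\sigma_{j-2}\cdots\sigma_{i+1})\,\sigma_i\,(\sigma_{j-1}\sigma_{j-2}\cdots\sigma_{i+1})^{-1},\qquad 1\le i<j\le n.$$ For a word $W$ in the letters $a_{ij}^{\pm1}$ let $\mathtt{nb}(W)$ be the number of letters $a_{ij}^{-1}$ in $W$; for $\beta\in B_n$ let $\mathtt{nb}(\beta)=\min\{\mathtt{nb}(W): W \text{ represents } \beta\}$, and let $\|\beta\|$ be the minimal length of a word representing $\beta$. Call a braid positive if it is represented by a word in the $a_{ij}$, and write $V\le W$ if $W=PVQ$ with $P,Q$ positive. Let $\delta=\sigma_{n-1}\cdots\sigma_2\sigma_1$ and $\tau(\beta)=\delta^{-1}\beta\delta$. A canonical factor is a braid $A$ with $e\le A\le\delta$. For canonical factors $A,B$, the product $AB$ is maximally left-weighted if there are no canonical factors $A',B'$ with $(A',B')\ne(A,B)$, $AB=A'B'$ and $A'=AQ$ for some canonical factor $Q$. The left-canonical form $\mathtt{LCF}(\beta)$ is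 the factorization $\beta=\delta^rA_1\cdots A_k$ with $r\in\mathbb Z$, $k\ge 0$, canonical factors $A_i\notin\{e,\delta\}$, and every $A_iA_{i+1}$ maximally left-weighted. For an expression $U=\delta^rW_1\cdots W_s$ in which each $W_i$ or $W_i^{-1}$ is a canonical factor different from $e$ and $\delta$, define $\mathtt{red}(U)$ as follows. If $r\ge 0$, or if $W_i<e$ for all $i$, then $\mathtt{red}(U)=U$. Otherwise choose a $W_k$ whose length $\|W_k\|$ is maximal among those $W_i$ that are canonical factors, let $V_k$ be the canonical factor with $W_kV_k=\delta$, and put $$\mathtt{red}(U)=\delta^{r+1}\,\tau(W_1)\cdots\tau(W_{k-1})\,V_k^{-1}\,W_{k+1}\cdots W_s .$$ Put $\mathtt{Red}(U)=\mathtt{red}^{|r|}(U)$; it depends on the choices made. A reduced word of $\mathtt{LCF}(\beta)$ is a band word obtained from some $\mathtt{Red}(\mathtt{LCF}(\beta))$ by writing $\delta^{\pm1}$ as $(a_{n-1,n}\cdots a_{2,3}a_{1,2})^{\pm1}$, each canonical factor as a word in positive bands $a_{ij}$, and each inverse of a canonical factor as a word in negative bands $a_{ij}^{-1}$. Then for every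 $\beta\in B_n$, every reduced word $W$ of $\mathtt{LCF}(\beta)$ represents $\beta$ and satisfies $\mathtt{nb}(W)=\mathtt{nb}(\beta)$. -/

import Mathlib

/-- Artin's relators on the generators `σ_0, …, σ_{n-2}` (strands are numbered `0, …, n-1`, so
`σ_k` exchanges the strands `k` and `k + 1`). -/
def braidRels (n : ℕ) : Set (FreeGroup (Fin (n - 1))) :=
  {w | ∃ i j : Fin (n - 1), (i : ℕ) + 1 < (j : ℕ) ∧
      w = (FreeGroup.of i * FreeGroup.of j) * (FreeGroup.of j * FreeGroup.of i)⁻¹} ∪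
  {w | ∃ i j : Fin (n - 1), (i : ℕ) + 1 = (j : ℕ) ∧
      w = (FreeGroup.of i * FreeGroup.of j * FreeGroup.of i) *
        (FreeGroup.of j * FreeGroup.of i * FreeGroup.of j)⁻¹}

/-- The braid group `B_n` in Artin's presentation. -/
abbrev BraidGroup (n : ℕ) : Type := PresentedGroup (braidRels n)

namespace BraidGroup

/-- The Artin generator `σ_k`. -/
def sigma {n : ℕ} (k : Fin (n - 1)) : BraidGroup n := PresentedGroup.of k

/-- An index `(i, j)`, `i < j`, of a band generator. -/
abbrev Band (n : ℕ) : Type := {p : Fin n × Fin n // p.1 < p.2}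

/-- `σ_{j-1} σ_{j-2} ⋯ σ_{i+1}`. -/
def descending {n : ℕ} (i j : Fin n) : BraidGroup n :=
  (((List.finRange (n - 1)).reverse.filter
    (fun k : Fin (n - 1) => decide ((i : ℕ) < (k : ℕ) ∧ (k : ℕ) < (j : ℕ)))).map sigma).prod

/-- The band generator
`a_{ij} = (σ_{j-1} ⋯ σ_{i+1}) σ_i (σ_{j-1} ⋯ σ_{i+1})⁻¹`. -/
def band {n : ℕ} (b : Band n) : BraidGroup n :=
  descending b.1.1 b.1.2 *
    sigma ⟨(b.1.1 : ℕ), by have h := b.2; have h' := b.1.2.isLt; rw [Fin.lt_def] at h; omega⟩ *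
    (descending b.1.1 b.1.2)⁻¹

/-- Words in the band generators: `(b, true)` is the positive band `a_b`, and `(b, false)` is the
negative band `a_b⁻¹`. -/
abbrev BandWord (n : ℕ) : Type := List (Band n × Bool)

/-- The braid represented by a word. -/
def BandWord.eval {n : ℕ} (W : BandWord n) : BraidGroup n :=
  (W.map (fun x => if x.2 then band x.1 else (band x.1)⁻¹)).prod

def BandWord.Represents {n : ℕ} (W : BandWord n) (β : BraidGroup n) : Prop := W.eval = β

/-- The number of negative bands of a word. -/
def BandWord.nb {n : ℕ} (W : BandWord n) : ℕ := W.countP (fun x => !x.2)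

/-- The negative band number of a braid (the set is nonempty, since every `σ_k` is a band). -/
noncomputable def nb {n : ℕ} (β : BraidGroup n) : ℕ :=
  sInf {m : ℕ | ∃ W : BandWord n, W.Represents β ∧ W.nb = m}

/-- The word length `‖β‖`: the minimal length of a word in the band generators for `β`. -/
noncomputable def wordLength {n : ℕ} (β : BraidGroup n) : ℕ :=
  sInf {m : ℕ | ∃ W : BandWord n, W.Represents β ∧ W.length = m}

def BandWord.IsPositive {n : ℕ} (W : BandWord n) : Prop := ∀ x ∈ W, x.2 = true

def BandWord.IsNegative {n : ℕ} (W : BandWord n) : Prop := ∀ x ∈ W, x.2 = false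

/-- A braid is positive if it is represented by a word in positive bands. -/
def IsPositive {n : ℕ} (β : BraidGroup n) : Prop :=
  ∃ W : BandWord n, W.IsPositive ∧ W.Represents β

/-- The partial order `V ≤ W`: `W = P V Q` with `P`, `Q` positive. -/
def Le {n : ℕ} (V W : BraidGroup n) : Prop :=
  ∃ P Q : BraidGroup n, IsPositive P ∧ IsPositive Q ∧ W = P * V * Q

/-- `δ = σ_{n-1} ⋯ σ_2 σ_1` (in one-based numbering). -/
def delta (n : ℕ) : BraidGroup n := ((List.finRange (n - 1)).reverse.map sigma).prod

/-- `τ(β) = δ⁻¹ β δ`. -/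
def tau {n : ℕ} (β : BraidGroup n) : BraidGroup n := (delta n)⁻¹ * β * delta n

/-- Canonical factors: `e ≤ A ≤ δ`. -/
def IsCanonicalFactor {n : ℕ} (A : BraidGroup n) : Prop := Le 1 A ∧ Le A (delta n)

/-- Canonical factors other than `e` and `δ`. -/
def IsProperFactor {n : ℕ} (A : BraidGroup n) : Prop :=
  IsCanonicalFactor A ∧ A ≠ 1 ∧ A ≠ delta n

/-- `A ≺ B`: `A Q = B` for a canonical factor `Q`. -/
def Prec {n : ℕ} (A B : BraidGroup n) : Prop :=
  ∃ Q : BraidGroup n, IsCanonicalFactor Q ∧ A * Q = B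

/-- `A B ⇒ A' B'`: the same braid, and `A ≺ A'`. -/
def MoreLeftWeighted {n : ℕ} (A B A' B' : BraidGroup n) : Prop :=
  A * B = A' * B' ∧ Prec A A'

/-- `A B` is maximally left-weighted: the only `A' B'` with `A B ⇒ A' B'` is `A B` itself. -/
def MaximallyLeftWeighted {n : ℕ} (A B : BraidGroup n) : Prop :=
  ∀ A' B' : BraidGroup n, IsCanonicalFactor A' → IsCanonicalFactor B' →
    MoreLeftWeighted A B A' B' → A' = A ∧ B' = B

/-- A formal expression `δ^r W_1 W_2 ⋯ W_s`. -/
structure DeltaWord (n : ℕ) where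
  exponent : ℤ
  factors : List (BraidGroup n)

/-- `L` is the left-canonical form `δ^r A_1 ⋯ A_k` of `β`. -/
def IsLCF {n : ℕ} (β : BraidGroup n) (L : DeltaWord n) : Prop :=
  β = delta n ^ L.exponent * L.factors.prod ∧
  (∀ A ∈ L.factors, IsProperFactor A) ∧
  L.factors.IsChain MaximallyLeftWeighted

/-- One reduction step; `IsRed U V` says that `V` is one of the possible values of `red(U)`, for
`U = δ^r W_1 ⋯ W_s` with each `W_i` or `W_i⁻¹` a canonical factor other than `e` and `δ`.
* If `r ≥ 0` or all `W_i < e`, nothing changes.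
* If `r < 0` and some `W_i` is a canonical factor, choose one, `W_k`, of maximal word length among
  them, let `W_k V_k = δ`, and pass to
  `δ^{r+1} τ(W_1) ⋯ τ(W_{k-1}) V_k⁻¹ W_{k+1} ⋯ W_s`. -/
inductive IsRed {n : ℕ} : DeltaWord n → DeltaWord n → Prop
  | stay (U : DeltaWord n)
      (h : 0 ≤ U.exponent ∨ ∀ A ∈ U.factors, Le A 1 ∧ A ≠ 1) : IsRed U U
  | step (r : ℤ) (l₁ l₂ : List (BraidGroup n)) (A V : BraidGroup n)
      (hr : r < 0) (hA : IsCanonicalFactor A)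
      (hmax : ∀ B ∈ l₁ ++ A :: l₂, IsCanonicalFactor B → wordLength B ≤ wordLength A)
      (hV : IsCanonicalFactor V) (hAV : A * V = delta n) :
      IsRed ⟨r, l₁ ++ A :: l₂⟩ ⟨r + 1, l₁.map tau ++ V⁻¹ :: l₂⟩

/-- `V` is one of the possible values of `red^m(U)`. -/
def IsRedIter {n : ℕ} : ℕ → DeltaWord n → DeltaWord n → Prop
  | 0, U, V => V = U
  | m + 1, U, V => ∃ U' : DeltaWord n, IsRed U U' ∧ IsRedIter m U' V

/-- `V` is one of the possible values of `Red(U) = red^{|r|}(U)`. -/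
def IsReduction {n : ℕ} (U V : DeltaWord n) : Prop := IsRedIter U.exponent.natAbs U V

/-- The word `a_{n-1,n} ⋯ a_{2,3} a_{1,2}` (one-based) for `δ = σ_{n-1} ⋯ σ_2 σ_1`. -/
def deltaWord (n : ℕ) : BandWord n :=
  (List.finRange (n - 1)).reverse.map fun k : Fin (n - 1) =>
    (⟨(⟨k, by have := k.isLt; omega⟩, ⟨(k : ℕ) + 1, by have := k.isLt; omega⟩),
      by rw [Fin.lt_def]; exact Nat.lt_succ_self _⟩, true)

/-- The word for `δ^r`: `|r|` copies of the word for `δ`, or of its inverse word if `r < 0`. -/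
def deltaPowWord (n : ℕ) (r : ℤ) : BandWord n :=
  (List.replicate r.natAbs
    (if 0 ≤ r then deltaWord n else FreeGroup.invRev (deltaWord n))).flatten

/-- `u` is a band word for the factor `A`: a word in positive bands if `A` is a canonical factor,
and a word in negative bands if `A` is the inverse of one. -/
def IsFactorWord {n : ℕ} (A : BraidGroup n) (u : BandWord n) : Prop :=
  u.Represents A ∧
    ((IsCanonicalFactor A ∧ u.IsPositive) ∨ (IsCanonicalFactor A⁻¹ ∧ u.IsNegative))

/-- `W` is a band word that writes out `δ^r W_1 ⋯ W_s` factor by factor. -/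
def DeltaWord.IsWrittenAs {n : ℕ} (U : DeltaWord n) (W : BandWord n) : Prop :=
  ∃ us : List (BandWord n), List.Forall₂ IsFactorWord U.factors us ∧
    W = deltaPowWord n U.exponent ++ us.flatten

/-- `W` is a reduced word `Red(LCF(β))` of the left-canonical form of `β`. -/
def IsReducedWordOfLCF {n : ℕ} (β : BraidGroup n) (W : BandWord n) : Prop :=
  ∃ L R : DeltaWord n, IsLCF β L ∧ IsReduction L R ∧ R.IsWrittenAs W

end BraidGroup

/-! Put N = n - 1, and for 0 ≤ c ≤ N attach to δ^r A_1 ⋯ A_k the number D(c) = -c r - Σ max(0, c - N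
+ ‖A_i‖). If r < 0, both nb(β) and the number of negative letters of any reduced word equal the
maximum of D; if r ≥ 0, reduced words are positive.

Upper bound (`IsRedIter.cost_le`): extend D to expressions with inverse factors
(`DeltaWord.defect`). Replacing a longest factor A keeps D(c) for c ≥ N - ‖A‖, and for smaller c the
new D(c) is at most the old D(N - ‖A‖). So a bound on all D(c) survives every step. At the end the
number of negative letters is D(0) if the exponent is 0, and D(N) if no positive factor is left.

Lower bound (`Realization.defect_le`): give a simple element of length l a tent-shaped weight, which
has slope c up to l = N - c and then slope c - N, ending at 0 for l = N. Left multiplication by a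
band changes the total weight of a normal form by at least c - N and at most c. A word with p
positive and q negative letters thus has weight at most c p + (N - c) q; since p - q is the exponent
sum, this says D(c) ≤ q. The weight estimate is where n ≤ 4 enters: a band pushed into a normal form
is absorbed by a factor, or stops in front of it, or passes it as a single band without changing its
length.

For the weight to be a function of the braid, B_n is made to act on normal forms modulo right powers
of δ. The action comes from finite tables (`HeadSystem`) whose axioms are decided by exhaustion, and
the image of the empty form recovers the left-canonical form (`Realization.ρ_prod_val`). For n ≤ 2
there are no proper factors. -/

namespace BraidGroup

variable {n : ℕ}

/-! ### The exponent sum -/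

/-- The exponent sum as a homomorphism. -/
def degHom (n : ℕ) : BraidGroup n →* Multiplicative ℤ :=
  PresentedGroup.toGroup (f := fun _ => Multiplicative.ofAdd 1) (by
    rintro w (⟨i, j, -, rfl⟩ | ⟨i, j, -, rfl⟩) <;> simp)

/-- The exponent sum of a braid. -/
def deg (β : BraidGroup n) : ℤ := (degHom n β).toAdd

@[simp] theorem deg_one : deg (1 : BraidGroup n) = 0 := by simp [deg]

@[simp] theorem deg_mul (α β : BraidGroup n) : deg (α * β) = deg α + deg β := by simp [deg]

@[simp] theorem deg_inv (α : BraidGroup n) : deg α⁻¹ = -deg α := by simp [deg]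

@[simp] theorem deg_zpow (α : BraidGroup n) (r : ℤ) : deg (α ^ r) = r * deg α := by
  simp [deg]

theorem deg_list_prod (l : List (BraidGroup n)) : deg l.prod = (l.map deg).sum := by
  induction l with
  | nil => simp
  | cons a l ih => simp [ih]

@[simp] theorem deg_sigma (k : Fin (n - 1)) : deg (sigma k : BraidGroup n) = 1 := by
  simp [deg, sigma, degHom]

@[simp] theorem deg_band (b : Band n) : deg (band b) = 1 := by simp [band]

@[simp] theorem deg_delta : deg (delta n) = ((n - 1 : ℕ) : ℤ) := by
  simp [delta, deg_list_prod, List.map_map, Function.comp_def]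

@[simp] theorem deg_tau (α : BraidGroup n) : deg (tau α) = deg α := by
  simp only [tau, deg_mul, deg_inv]; ring

/-! ### Band words -/

namespace BandWord

@[simp] theorem eval_nil : eval ([] : BandWord n) = 1 := rfl

theorem eval_cons (x : Band n × Bool) (W : BandWord n) :
    eval (x :: W) = (if x.2 then band x.1 else (band x.1)⁻¹) * eval W := by
  simp [eval]

@[simp] theorem eval_append (V W : BandWord n) : eval (V ++ W) = eval V * eval W := by
  simp [eval]

@[simp] theorem nb_nil : nb ([] : BandWord n) = 0 := rfl

@[simp] theorem nb_append (V W : BandWord n) : nb (V ++ W) = nb V + nb W := by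
  simp [nb]

theorem deg_eval (W : BandWord n) : deg W.eval = W.length - 2 * W.nb := by
  induction W with
  | nil => simp
  | cons x W ih =>
    rcases x with ⟨b, _ | _⟩
    · simp [eval_cons, ih, nb]; ring
    · simp [eval_cons, ih, nb]; ring

theorem IsPositive.nb_eq {W : BandWord n} (h : W.IsPositive) : W.nb = 0 := by
  rw [nb, List.countP_eq_zero]
  intro x hx
  simp [h x hx]

theorem IsNegative.nb_eq {W : BandWord n} (h : W.IsNegative) : W.nb = W.length := by
  rw [nb, List.countP_eq_length]
  intro x hx
  simp [h x hx]

theorem eval_invRev (W : BandWord n) : eval (FreeGroup.invRev W) = (eval W)⁻¹ := by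
  induction W with
  | nil => simp [FreeGroup.invRev]
  | cons x W ih =>
    have : FreeGroup.invRev (x :: W) = FreeGroup.invRev W ++ [(x.1, !x.2)] := by
      simp [FreeGroup.invRev]
    rw [this, eval_append, ih, eval_cons, eval_cons, mul_inv_rev]
    rcases x with ⟨b, _ | _⟩ <;> simp

theorem IsPositive.invRev {W : BandWord n} (h : W.IsPositive) :
    BandWord.IsNegative (FreeGroup.invRev W) := by
  intro x hx
  simp only [FreeGroup.invRev, List.mem_reverse, List.mem_map] at hx
  obtain ⟨y, hy, rfl⟩ := hx
  simp [h y hy]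

end BandWord

/-! ### Positive braids and canonical factors -/

theorem IsPositive.one : IsPositive (1 : BraidGroup n) := ⟨[], by simp [BandWord.IsPositive], rfl⟩

theorem IsPositive.mul {α β : BraidGroup n} (hα : IsPositive α) (hβ : IsPositive β) :
    IsPositive (α * β) := by
  obtain ⟨V, hV, rfl⟩ := hα
  obtain ⟨W, hW, rfl⟩ := hβ
  refine ⟨V ++ W, ?_, BandWord.eval_append V W⟩
  intro x hx
  rcases List.mem_append.1 hx with h | h
  exacts [hV x h, hW x h]

theorem isPositive_band (b : Band n) : IsPositive (band b) :=
  ⟨[(b, true)], by simp [BandWord.IsPositive], by simp [BandWord.Represents, BandWord.eval]⟩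

theorem IsPositive.deg_nonneg {α : BraidGroup n} (h : IsPositive α) : 0 ≤ deg α := by
  obtain ⟨W, hW, rfl⟩ := h
  rw [BandWord.deg_eval, hW.nb_eq]
  simp

theorem IsPositive.eq_one {α : BraidGroup n} (h : IsPositive α) (h0 : deg α = 0) : α = 1 := by
  obtain ⟨W, hW, rfl⟩ := h
  rw [BandWord.deg_eval, hW.nb_eq] at h0
  have : W = [] := by
    rw [← List.length_eq_zero_iff]; simpa using h0
  simp [this]

theorem isPositive_of_one_le {α : BraidGroup n} (h : Le 1 α) : IsPositive α := by
  obtain ⟨P, Q, hP, hQ, rfl⟩ := h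
  simpa using hP.mul hQ

theorem IsPositive.one_le {α : BraidGroup n} (h : IsPositive α) : Le 1 α :=
  ⟨α, 1, h, .one, by simp⟩

theorem Le.deg_le {α β : BraidGroup n} (h : Le α β) : deg α ≤ deg β := by
  obtain ⟨P, Q, hP, hQ, rfl⟩ := h
  have := hP.deg_nonneg
  have := hQ.deg_nonneg
  simp only [deg_mul]; linarith

namespace IsCanonicalFactor

variable {A : BraidGroup n}

theorem isPositive (h : IsCanonicalFactor A) : IsPositive A := isPositive_of_one_le h.1

theorem deg_nonneg (h : IsCanonicalFactor A) : 0 ≤ deg A := h.isPositive.deg_nonneg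

theorem deg_le (h : IsCanonicalFactor A) : deg A ≤ ((n - 1 : ℕ) : ℤ) := by
  simpa using h.2.deg_le

/-- The exponent sum is at most the length of any word, with equality for positive words. This lets
degrees replace word lengths from here on. -/
theorem wordLength_eq (h : IsCanonicalFactor A) : (wordLength A : ℤ) = deg A := by
  obtain ⟨W, hW, hWA⟩ := h.isPositive
  have hdeg : deg A = W.length := by
    rw [← hWA, BandWord.deg_eval, hW.nb_eq]; simp
  have hmem : W.length ∈ {m : ℕ | ∃ W : BandWord n, W.Represents A ∧ W.length = m} :=
    ⟨W, hWA, rfl⟩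
  rw [hdeg, Nat.cast_inj]
  refine le_antisymm (Nat.sInf_le hmem) ?_
  refine le_csInf ⟨_, hmem⟩ ?_
  rintro m ⟨V, hV, rfl⟩
  have h1 := BandWord.deg_eval V
  rw [show V.eval = A from hV, hdeg] at h1
  omega

end IsCanonicalFactor

namespace IsProperFactor

variable {A : BraidGroup n}

theorem deg_pos (h : IsProperFactor A) : 0 < deg A :=
  lt_of_le_of_ne h.1.deg_nonneg fun h0 => h.2.1 (h.1.isPositive.eq_one h0.symm)

theorem deg_lt (h : IsProperFactor A) : deg A < ((n - 1 : ℕ) : ℤ) := by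
  refine lt_of_le_of_ne h.1.deg_le fun h0 => h.2.2 ?_
  obtain ⟨P, Q, hP, hQ, hd⟩ := h.1.2
  have h1 := congrArg deg hd
  simp only [deg_mul, deg_delta] at h1
  have h2 := hP.deg_nonneg
  have h3 := hQ.deg_nonneg
  rw [hd, hP.eq_one (by linarith), hQ.eq_one (by linarith)]
  simp

end IsProperFactor

/-! ### Writing out `δ^r W_1 ⋯ W_s` -/

theorem IsFactorWord.nb_eq {A : BraidGroup n} {u : BandWord n} (h : IsFactorWord A u) :
    (u.nb : ℤ) = max 0 (-deg A) := by
  obtain ⟨rfl, ⟨-, hu⟩ | ⟨-, hu⟩⟩ := h <;> rw [BandWord.deg_eval, hu.nb_eq]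
  · simp
  · rw [max_eq_right] <;> omega

theorem band_succ (k : Fin (n - 1)) (h : (⟨k, by have := k.isLt; omega⟩ : Fin n) <
      ⟨(k : ℕ) + 1, by have := k.isLt; omega⟩) :
    band (⟨(⟨k, by have := k.isLt; omega⟩, ⟨(k : ℕ) + 1, by have := k.isLt; omega⟩), h⟩ : Band n)
      = sigma k := by
  have : descending (⟨k, by have := k.isLt; omega⟩ : Fin n)
      ⟨(k : ℕ) + 1, by have := k.isLt; omega⟩ = 1 := by
    rw [descending, List.filter_eq_nil_iff.2]
    · rfl
    · intro a _; simp only [decide_eq_true_eq]; omega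
  simp [band, this]

theorem eval_deltaWord : (deltaWord n).eval = delta n := by
  simp only [BandWord.eval, deltaWord, List.map_map, delta]
  congr 1
  refine List.map_congr_left fun k _ => ?_
  simp only [Function.comp_apply, if_true]
  exact band_succ k _

theorem isPositive_deltaWord : (deltaWord n).IsPositive := by
  intro x hx
  simp only [deltaWord, List.mem_map] at hx
  obtain ⟨k, -, rfl⟩ := hx
  rfl

theorem length_deltaWord : (deltaWord n).length = n - 1 := by simp [deltaWord]

theorem BandWord.eval_replicate_flatten (m : ℕ) (W : BandWord n) :
    BandWord.eval (List.replicate m W).flatten = W.eval ^ m := by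
  induction m with
  | zero => simp
  | succ m ih => rw [List.replicate_succ, List.flatten_cons, eval_append, ih, pow_succ']

theorem BandWord.nb_replicate_flatten (m : ℕ) (W : BandWord n) :
    BandWord.nb (List.replicate m W).flatten = m * W.nb := by
  induction m with
  | zero => simp
  | succ m ih => rw [List.replicate_succ, List.flatten_cons, nb_append, ih]; ring

theorem eval_deltaPowWord (r : ℤ) : (deltaPowWord n r).eval = delta n ^ r := by
  rw [deltaPowWord, BandWord.eval_replicate_flatten]
  split_ifs with h
  · rw [eval_deltaWord]
    obtain ⟨m, rfl⟩ := Int.eq_ofNat_of_zero_le h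
    simp
  · rw [BandWord.eval_invRev, eval_deltaWord]
    obtain ⟨m, rfl⟩ : ∃ m : ℕ, r = -m := ⟨r.natAbs, by omega⟩
    simp

theorem nb_deltaPowWord (r : ℤ) :
    ((deltaPowWord n r).nb : ℤ) = max 0 (-(((n - 1 : ℕ) : ℤ) * r)) := by
  rw [deltaPowWord, BandWord.nb_replicate_flatten]
  split_ifs with h
  · rw [isPositive_deltaWord.nb_eq]
    have : 0 ≤ ((n - 1 : ℕ) : ℤ) * r := by positivity
    rw [max_eq_left] <;> simp [this]
  · rw [isPositive_deltaWord.invRev.nb_eq, FreeGroup.invRev_length, length_deltaWord]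
    obtain ⟨m, rfl⟩ : ∃ m : ℕ, r = -m := ⟨r.natAbs, by omega⟩
    rw [max_eq_right]
    · push_cast; simp; ring
    · have : 0 ≤ ((n - 1 : ℕ) : ℤ) * m := by positivity
      linarith

namespace DeltaWord

/-- The braid `δ^r W_1 ⋯ W_s`. -/
def value (U : DeltaWord n) : BraidGroup n := delta n ^ U.exponent * U.factors.prod

/-- The number of negative bands of a band word that writes out `δ^r W_1 ⋯ W_s`. -/
def cost (U : DeltaWord n) : ℤ :=
  max 0 (-(((n - 1 : ℕ) : ℤ) * U.exponent)) + (U.factors.map fun A => max 0 (-deg A)).sum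

theorem IsWrittenAs.eval_eq {U : DeltaWord n} {W : BandWord n} (h : U.IsWrittenAs W) :
    W.eval = U.value := by
  obtain ⟨us, hus, rfl⟩ := h
  rw [BandWord.eval_append, eval_deltaPowWord, value]
  congr 1
  generalize U.factors = l at hus
  induction hus with
  | nil => simp
  | cons h _ ih => rw [List.flatten_cons, BandWord.eval_append, ih, List.prod_cons, h.1]

theorem IsWrittenAs.nb_eq {U : DeltaWord n} {W : BandWord n} (h : U.IsWrittenAs W) :
    (W.nb : ℤ) = U.cost := by
  obtain ⟨us, hus, rfl⟩ := h
  rw [BandWord.nb_append, Nat.cast_add, nb_deltaPowWord, cost]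
  congr 1
  generalize U.factors = l at hus
  induction hus with
  | nil => simp
  | cons h _ ih =>
    rw [List.flatten_cons, BandWord.nb_append, Nat.cast_add, ih, h.nb_eq, List.map_cons,
      List.sum_cons]

/-- The number of negative bands that is left to be explained after replacing `-r` factors of `U`,
if only factors of length more than `n - 1 - c` profit from it. -/
def defect (c : ℤ) (U : DeltaWord n) : ℤ :=
  (U.factors.map fun A => max 0 (-deg A) - max 0 (c - ((n - 1 : ℕ) : ℤ) + deg A)).sum
    - c * U.exponent

end DeltaWord

/-! ### Reduction steps -/

theorem prod_map_tau (l : List (BraidGroup n)) :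
    delta n * (l.map tau).prod = l.prod * delta n := by
  induction l with
  | nil => simp
  | cons a l ih =>
    have : delta n * (tau a * (l.map tau).prod) = a * (delta n * (l.map tau).prod) := by
      simp only [tau]; group
    rw [List.map_cons, List.prod_cons, this, ih, List.prod_cons, mul_assoc]

/-- One factor δ moves right through `l₁`, undoing `tau`, and is then used up in A = δ V⁻¹. -/
theorem IsRed.value_eq {U V : DeltaWord n} (h : IsRed U V) : V.value = U.value := by
  cases h with
  | stay => rfl
  | step r l₁ l₂ A V hr hA hmax hV hAV =>
    simp only [DeltaWord.value, List.prod_append, List.prod_cons, zpow_add_one]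
    have := prod_map_tau l₁
    calc _ = delta n ^ r * (delta n * (l₁.map tau).prod) * (V⁻¹ * l₂.prod) := by group
      _ = delta n ^ r * l₁.prod * (delta n * V⁻¹) * l₂.prod := by rw [this]; group
      _ = _ := by rw [← hAV]; group

theorem IsRedIter.value_eq {m : ℕ} {U V : DeltaWord n} (h : IsRedIter m U V) :
    V.value = U.value := by
  induction m generalizing U with
  | zero => rw [show V = U from h]
  | succ m ih =>
    obtain ⟨U', h1, h2⟩ := h
    rw [ih h2, h1.value_eq]

theorem IsRedIter.eq_of_negative {m : ℕ} {U V : DeltaWord n} (h : IsRedIter m U V)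
    (hU : ∀ A ∈ U.factors, Le A 1 ∧ A ≠ 1) : V = U := by
  induction m with
  | zero => exact h
  | succ m ih =>
    obtain ⟨U', h1, h2⟩ := h
    cases h1 with
    | stay => exact ih h2
    | step r l₁ l₂ A V hr hA hmax hV hAV =>
      obtain ⟨h3, h4⟩ := hU A (by simp)
      have h5 := h3.deg_le
      have h6 := hA.deg_nonneg
      rw [deg_one] at h5
      exact absurd (hA.isPositive.eq_one (le_antisymm h5 h6)) h4

theorem IsRedIter.eq_of_nonneg {m : ℕ} {U V : DeltaWord n} (h : IsRedIter m U V)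
    (hU : 0 ≤ U.exponent) : V = U := by
  induction m with
  | zero => exact h
  | succ m ih =>
    obtain ⟨U', h1, h2⟩ := h
    cases h1 with
    | stay => exact ih h2
    | step r l₁ l₂ A V hr => exact absurd hU (not_le.2 hr)

/-- A bound for all defects of `U` bounds the number of negative bands of its reductions. -/
theorem IsRedIter.cost_le (hτ : ∀ A : BraidGroup n, IsCanonicalFactor A → IsCanonicalFactor (tau A))
    {m : ℕ} {U V : DeltaWord n} {b : ℤ} (h : IsRedIter m U V) (hm : U.exponent = -m)
    (hU : ∀ A ∈ U.factors, IsCanonicalFactor A ∨ deg A ≤ 0)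
    (hb : ∀ c : ℤ, 0 ≤ c → c ≤ ((n - 1 : ℕ) : ℤ) → U.defect c ≤ b) : V.cost ≤ b := by
  have hN : (0 : ℤ) ≤ ((n - 1 : ℕ) : ℤ) := by positivity
  induction m generalizing U with
  | zero =>
    rw [show V = U from h]
    -- At exponent 0 the cost is the defect for c = 0: no factor is longer than δ, so the second
    -- maximum vanishes.
    refine le_trans (le_of_eq ?_) (hb 0 le_rfl hN)
    simp only [Nat.cast_zero, neg_zero] at hm
    simp only [DeltaWord.cost, DeltaWord.defect, hm, mul_zero, neg_zero, max_self, zero_add,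
      sub_zero]
    refine congrArg List.sum (List.map_congr_left fun A hA => ?_)
    have : deg A ≤ ((n - 1 : ℕ) : ℤ) := by
      rcases hU A hA with h | h
      · exact h.deg_le
      · omega
    omega
  | succ m ih =>
    obtain ⟨U', h1, h2⟩ := h
    cases h1 with
    | stay _ hs =>
      rcases hs with hs | hs
      · push_cast at hm; omega
      rw [h2.eq_of_negative hs]
      -- Once all factors are negative, the cost is the defect for c = n - 1: the powers of δ
      -- account for -(n - 1) r, and no factor has positive degree.
      refine le_trans (le_of_eq ?_) (hb _ hN le_rfl)
      have h3 : 0 ≤ -(((n - 1 : ℕ) : ℤ) * U.exponent) := by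
        rw [hm, mul_neg, neg_neg]; positivity
      rw [DeltaWord.cost, DeltaWord.defect, max_eq_right h3, add_comm, sub_eq_add_neg]
      congr 1
      refine congrArg List.sum (List.map_congr_left fun A hA => ?_)
      have := (hs A hA).1.deg_le
      rw [deg_one] at this
      omega
    | step r l₁ l₂ A W hr hA hmax hW hAW =>
      have hdA := hA.deg_nonneg
      have hdA' := hA.deg_le
      have hdW : deg W = ((n - 1 : ℕ) : ℤ) - deg A := by
        have := congrArg deg hAW
        rw [deg_mul, deg_delta] at this
        linarith
      have hle : ∀ B ∈ l₁ ++ A :: l₂, deg B ≤ deg A := by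
        intro B hB
        rcases hU B hB with h | h
        · rw [← h.wordLength_eq, ← hA.wordLength_eq]
          exact_mod_cast hmax B hB h
        · omega
      refine ih h2 (by simp only at hm ⊢; push_cast at hm; omega) ?_ ?_
      · intro B hB
        simp only [List.mem_append, List.mem_map, List.mem_cons] at hB
        rcases hB with ⟨B, hB, rfl⟩ | rfl | hB
        · rw [deg_tau]
          exact (hU B (by simp [hB])).imp_left (hτ B)
        · right; rw [deg_inv, hdW]; omega
        · exact hU B (by simp [hB])
      · intro c hc0 hcn
        have hd : ∀ (c r : ℤ) (l₁ l₂ : List (BraidGroup n)) (B : BraidGroup n),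
            DeltaWord.defect c ⟨r, l₁ ++ B :: l₂⟩ =
              ((l₁ ++ l₂).map fun A => max 0 (-deg A) -
                max 0 (c - ((n - 1 : ℕ) : ℤ) + deg A)).sum
              + (max 0 (-deg B) - max 0 (c - ((n - 1 : ℕ) : ℤ) + deg B)) - c * r := by
          intro c r l₁ l₂ B
          simp only [DeltaWord.defect, List.map_append, List.map_cons, List.sum_append,
            List.sum_cons]
          ring
        have hτs : DeltaWord.defect c ⟨r + 1, l₁.map tau ++ W⁻¹ :: l₂⟩ =
            DeltaWord.defect c ⟨r + 1, l₁ ++ W⁻¹ :: l₂⟩ := by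
          simp only [DeltaWord.defect, List.map_append, List.map_map, Function.comp_def, deg_tau]
        rw [hτs, hd, deg_inv, hdW, mul_add]
        -- Above the threshold n - 1 - deg A the defect is unchanged. Below it, compare with the old
        -- defect at the threshold: there no factor contributes to the second maximum, as A is
        -- longest, and the remaining difference is the product in `h5`, nonnegative because r ≤ -1.
        rcases le_or_gt (((n - 1 : ℕ) : ℤ) - deg A) c with h | h
        · have := hb c hc0 hcn
          rw [hd] at this
          omega
        · have h3 := hb (((n - 1 : ℕ) : ℤ) - deg A) (by omega) (by omega)
          rw [hd] at h3
          have h4 : ((l₁ ++ l₂).map fun A => max 0 (-deg A) -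
                max 0 (c - ((n - 1 : ℕ) : ℤ) + deg A)).sum ≤
              ((l₁ ++ l₂).map fun B => max 0 (-deg B) -
                max 0 (((n - 1 : ℕ) : ℤ) - deg A - ((n - 1 : ℕ) : ℤ) + deg B)).sum := by
            refine List.sum_le_sum fun B hB => ?_
            have := hle B (by
              simp only [List.mem_append, List.mem_cons] at hB ⊢; tauto)
            omega
          have h5 : 0 ≤ (((n - 1 : ℕ) : ℤ) - deg A - c) * (-1 - r) :=
            mul_nonneg (by omega) (by omega)
          have h6 : (((n - 1 : ℕ) : ℤ) - deg A - c) * (-1 - r) =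
            -(((n - 1 : ℕ) : ℤ) - deg A) - (((n - 1 : ℕ) : ℤ) - deg A) * r + c + c * r := by ring
          omega

/-- If the braid represented by `L` has no word with fewer than `L.defect c` negative bands, for
all `c`, then the reduced words of `L` have the minimal number of negative bands. -/
theorem represents_and_nb_eq
    (hτ : ∀ A : BraidGroup n, IsCanonicalFactor A → IsCanonicalFactor (tau A))
    (hdefect : ∀ (L : DeltaWord n) (W : BandWord n), IsLCF W.eval L →
      ∀ c : ℤ, 0 ≤ c → c ≤ ((n - 1 : ℕ) : ℤ) → L.defect c ≤ W.nb)
    {β : BraidGroup n} {W : BandWord n} (hW : IsReducedWordOfLCF β W) :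
    W.Represents β ∧ W.nb = nb β := by
  obtain ⟨L, R, hL, hR, hRW⟩ := hW
  have hWβ : W.Represents β := by
    rw [BandWord.Represents, hRW.eval_eq, IsRedIter.value_eq hR, DeltaWord.value, ← hL.1]
  refine ⟨hWβ, ?_⟩
  have hmem : W.nb ∈ {m : ℕ | ∃ W : BandWord n, W.Represents β ∧ W.nb = m} := ⟨W, hWβ, rfl⟩
  refine le_antisymm (le_csInf ⟨_, hmem⟩ ?_) (Nat.sInf_le hmem)
  rintro m ⟨W', rfl, rfl⟩
  rw [← Nat.cast_le (α := ℤ), hRW.nb_eq]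
  rcases le_or_gt 0 L.exponent with h | h
  · rw [IsRedIter.eq_of_nonneg hR h, DeltaWord.cost, max_eq_left]
    · rw [zero_add]
      refine le_trans (le_of_eq ?_) (Nat.cast_nonneg _)
      refine List.sum_eq_zero fun x hx => ?_
      obtain ⟨A, hA, rfl⟩ := List.mem_map.1 hx
      have := (hL.2.1 A hA).1.deg_nonneg
      omega
    · have : 0 ≤ ((n - 1 : ℕ) : ℤ) * L.exponent := by positivity
      omega
  · exact IsRedIter.cost_le hτ hR (by omega) (fun A hA => .inl (hL.2.1 A hA).1)
      (hdefect L W' hL)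

end BraidGroup

/-! ### Garside normal forms -/

/-- The simple elements of a Garside monoid with Garside element `δ`, presented by the
left-greedy normalisation `s t = head s t * rest s t` of their products. The product of `s` and `t`
is simple iff `rest s t = e`, and then it is `head s t`. -/
structure HeadSystem (S : Type) where
  e : S
  δ : S
  head : S → S → S
  rest : S → S → S
  compl : S → S
  τ : S ≃ S
  e_ne_δ : e ≠ δ
  head_e_left : ∀ s, head e s = s
  head_e_right : ∀ s, head s e = s
  rest_e_left : ∀ s, rest e s = e
  rest_e_right : ∀ s, rest s e = e
  head_δ_left : ∀ s, head δ s = δ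
  head_δ_right : ∀ s, head s δ = δ
  rest_δ_left : ∀ s, rest δ s = s
  rest_δ_right : ∀ s, rest s δ = τ s
  eq_e_of_head : ∀ s t, head s t = e → t = e
  rest_eq_of_head : ∀ s t, head s t = s → rest s t = t
  head_compl : ∀ s, head s (compl s) = δ
  rest_compl : ∀ s, rest s (compl s) = e
  head_compl_left : ∀ s, head (compl s) (τ s) = δ
  rest_compl_left : ∀ s, rest (compl s) (τ s) = e
  head_τ : ∀ s t, head (τ s) (τ t) = τ (head s t)
  rest_τ : ∀ s t, rest (τ s) (τ t) = τ (rest s t)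
  -- The next three laws say that, for simple s t, normalising (s t) u at once or letting t and then
  -- s act on u gives the same head and the same remainder.
  head_head : ∀ s t, rest s t = e → ∀ u, head s (head t u) = head (head s t) u
  rest_rest : ∀ s t, rest s t = e → ∀ u, rest (rest s (head t u)) (rest t u) = e
  head_rest : ∀ s t, rest s t = e → ∀ u,
    head (rest s (head t u)) (rest t u) = rest (head s t) u
  exists_factor : ∀ s t, ∃ u, rest s u = e ∧ head s u = head s t ∧
    rest u (rest s t) = e ∧ head u (rest s t) = t

namespace HeadSystem

variable {S : Type} (H : HeadSystem S)

@[simp] theorem τ_e : H.τ H.e = H.e := by rw [← H.rest_δ_right, H.rest_e_left]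

@[simp] theorem τ_δ : H.τ H.δ = H.δ := by rw [← H.rest_δ_right, H.rest_δ_left]

@[simp] theorem τ_symm_δ : H.τ.symm H.δ = H.δ := by rw [Equiv.symm_apply_eq, τ_δ]

theorem τ_eq_e {s : S} : H.τ s = H.e ↔ s = H.e := by
  rw [← Equiv.eq_symm_apply, (Equiv.symm_apply_eq _).2 H.τ_e.symm]

theorem τ_eq_δ {s : S} : H.τ s = H.δ ↔ s = H.δ := by
  rw [← Equiv.eq_symm_apply, τ_symm_δ]

theorem map_τ_map_symm (L : List S) : (L.map H.τ.symm).map H.τ = L := by simp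

variable [DecidableEq S]

/-- Left multiplication of a product of simple elements by a simple element. -/
def mul : S → List S → List S
  | s, [] => if s = H.e then [] else [s]
  | s, t :: L => H.head s t :: mul (H.rest s t) L

theorem mul_cons (s t : S) (L : List S) :
    H.mul s (t :: L) = H.head s t :: H.mul (H.rest s t) L := rfl

theorem mul_e (L : List S) : H.mul H.e L = L := by
  induction L with
  | nil => simp [mul]
  | cons t L ih => rw [mul_cons, H.head_e_left, H.rest_e_left, ih]

/-- The two carries that reach the tail again have a simple product, by `rest_rest`, so the
induction hypothesis applies to them. -/
theorem mul_mul {s t : S} (h : H.rest s t = H.e) (L : List S) :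
    H.mul s (H.mul t L) = H.mul (H.head s t) L := by
  induction L generalizing s t with
  | nil =>
    by_cases ht : t = H.e
    · subst ht
      rw [mul_e, H.head_e_right]
    · have h2 : H.head s t ≠ H.e := fun h' => ht (H.eq_e_of_head s t h')
      simp [mul, ht, h2, h]
  | cons u L ih =>
    rw [mul_cons, mul_cons, mul_cons, H.head_head s t h, ih (H.rest_rest s t h u),
      H.head_rest s t h]

theorem mul_δ_cons (s : S) (L : List S) : H.mul s (H.δ :: L) = H.δ :: H.mul (H.τ s) L := by
  rw [mul_cons, H.head_δ_right, H.rest_δ_right]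

theorem mul_map (s : S) (L : List S) :
    H.mul (H.τ s) (L.map H.τ) = (H.mul s L).map H.τ := by
  induction L generalizing s with
  | nil =>
    simp only [mul, List.map_nil, τ_eq_e]
    split_ifs <;> rfl
  | cons t L ih => rw [List.map_cons, mul_cons, H.head_τ, H.rest_τ, ih, mul_cons, List.map_cons]

theorem mul_map_symm (s : S) (L : List S) :
    H.mul s (L.map H.τ.symm) = (H.mul (H.τ s) L).map H.τ.symm := by
  conv_rhs => rw [← H.map_τ_map_symm L, mul_map]
  simp

/-- This is δ τ(s) = s δ. Both sides are s · `compl s` · τ(s), since δ = s · `compl s` = `compl s` ·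
τ(s). -/
theorem mul_δ_mul (s : S) (L : List S) :
    H.mul H.δ (H.mul (H.τ s) L) = H.mul s (H.mul H.δ L) := by
  rw [← H.head_compl s, ← H.mul_mul (H.rest_compl s), H.mul_mul (H.rest_compl_left s),
    H.head_compl_left, H.head_compl]

/-- Products of simple elements are considered up to powers of `δ` on the right; this removes
leading factors `δ`. -/
def strip : List S → List S
  | [] => []
  | s :: L => if s = H.δ then (strip L).map H.τ.symm else s :: L

theorem strip_δ_cons (L : List S) : H.strip (H.δ :: L) = (H.strip L).map H.τ.symm := by
  simp [strip]

theorem strip_cons {s : S} (h : s ≠ H.δ) (L : List S) : H.strip (s :: L) = s :: L := by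
  simp [strip, h]

theorem strip_map (L : List S) : H.strip (L.map H.τ) = (H.strip L).map H.τ := by
  induction L with
  | nil => rfl
  | cons s L ih =>
    by_cases h : s = H.δ
    · subst h
      rw [List.map_cons, τ_δ, strip_δ_cons, strip_δ_cons, ih]
      simp
    · rw [H.strip_cons h, List.map_cons, H.strip_cons (by rwa [Ne, τ_eq_δ])]

theorem strip_map_symm (L : List S) : H.strip (L.map H.τ.symm) = (H.strip L).map H.τ.symm := by
  conv_rhs => rw [← H.map_τ_map_symm L, strip_map]
  simp

theorem strip_strip (L : List S) : H.strip (H.strip L) = H.strip L := by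
  induction L with
  | nil => rfl
  | cons s L ih =>
    by_cases h : s = H.δ
    · subst h
      rw [strip_δ_cons, strip_map_symm, ih]
    · rw [H.strip_cons h, H.strip_cons h]

/-- Multiplication descends to cosets of the powers of δ: δ L = τ⁻¹(L) δ, and the trailing δ is
dropped. -/
theorem strip_mul_strip (s : S) (L : List S) :
    H.strip (H.mul s (H.strip L)) = H.strip (H.mul s L) := by
  induction L generalizing s with
  | nil => rfl
  | cons t L ih =>
    by_cases h : t = H.δ
    · subst h
      rw [strip_δ_cons, mul_map_symm, strip_map_symm, ih, mul_δ_cons, strip_δ_cons]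
    · rw [H.strip_cons h]

/-- `L` is a left-greedy normal form without trailing `e`. -/
def IsNormal (L : List S) : Prop := H.mul H.δ L = H.δ :: L

variable {H}

theorem isNormal_nil : H.IsNormal [] := by simp [IsNormal, mul, H.e_ne_δ.symm]

/-- δ absorbs nothing from the factor after it, so testing with δ in front amounts to testing the
list itself, and it also covers the empty list. -/
theorem isNormal_cons_iff {s : S} {L : List S} :
    H.IsNormal (s :: L) ↔ H.mul s L = s :: L := by
  rw [IsNormal, mul_cons, H.head_δ_left, H.rest_δ_left, List.cons.injEq]
  simp

theorem IsNormal.of_cons {s : S} {L : List S} (h : H.IsNormal (s :: L)) : H.IsNormal L := by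
  cases L with
  | nil => exact isNormal_nil
  | cons t L =>
    rw [isNormal_cons_iff, mul_cons, List.cons.injEq] at h
    rw [isNormal_cons_iff, ← h.2, H.rest_eq_of_head s t h.1, ← H.rest_eq_of_head s t h.1, h.2]

/-- Normality means that δ can be put in front unchanged. With s = τ(s'), moving δ past s' reduces
this to the normality of `L`. -/
theorem IsNormal.mul {L : List S} (h : H.IsNormal L) (s : S) : H.IsNormal (H.mul s L) := by
  have := H.mul_δ_mul (H.τ.symm s) L
  rw [Equiv.apply_symm_apply] at this
  rw [IsNormal, this, show H.mul H.δ L = H.δ :: L from h, mul_δ_cons, Equiv.apply_symm_apply]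

theorem IsNormal.map {L : List S} (h : H.IsNormal L) : H.IsNormal (L.map H.τ) := by
  have := H.mul_map H.δ L
  rwa [τ_δ, show H.mul H.δ L = H.δ :: L from h, List.map_cons, τ_δ] at this

theorem IsNormal.map_symm {L : List S} (h : H.IsNormal L) : H.IsNormal (L.map H.τ.symm) := by
  rw [IsNormal, mul_map_symm, τ_δ, show H.mul H.δ L = H.δ :: L from h, List.map_cons, τ_symm_δ]

theorem IsNormal.strip {L : List S} (h : H.IsNormal L) : H.IsNormal (H.strip L) := by
  induction L with
  | nil => exact h
  | cons s L ih =>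
    by_cases hs : s = H.δ
    · subst hs
      rw [strip_δ_cons]
      exact (ih h.of_cons).map_symm
    · rwa [H.strip_cons hs]

/-- Normality is local: if the first two factors are left-weighted, the carry into the tail is the
second factor itself. -/
theorem isNormal_of_isChain {L : List S} (h : L.IsChain fun s t => H.head s t = s)
    (he : H.e ∉ L) : H.IsNormal L := by
  induction L with
  | nil => exact isNormal_nil
  | cons s L ih =>
    have hL : H.IsNormal L := ih h.tail fun h' => he (List.mem_cons_of_mem _ h')
    rw [isNormal_cons_iff]
    cases L with
    | nil => simp [HeadSystem.mul, show s ≠ H.e by rintro rfl; simp at he]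
    | cons t L =>
      have hst := (List.isChain_cons_cons.1 h).1
      rw [mul_cons, hst, H.rest_eq_of_head s t hst, isNormal_cons_iff.1 hL]

/-! ### The action on normal forms modulo powers of δ -/

variable (H)

/-- The normal forms without factors `δ`. -/
def State : Type := {L : List S // H.IsNormal L ∧ H.strip L = L}

variable {H}

theorem State.ext {x y : H.State} (h : x.1 = y.1) : x = y := Subtype.ext h

/-- The empty normal form. -/
def State.empty : H.State := ⟨[], isNormal_nil, rfl⟩

/-- Left multiplication by a simple element. -/
def State.act (s : S) (x : H.State) : H.State :=
  ⟨H.strip (H.mul s x.1), (x.2.1.mul s).strip, H.strip_strip _⟩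

/-- The inverse of left multiplication by `δ`. -/
def State.rotate (x : H.State) : H.State :=
  ⟨x.1.map H.τ, x.2.1.map, by rw [H.strip_map, x.2.2]⟩

theorem State.act_act {s t : S} (h : H.rest s t = H.e) (x : H.State) :
    (x.act t).act s = x.act (H.head s t) :=
  State.ext <| by
    change H.strip (H.mul s (H.strip (H.mul t x.1))) = H.strip (H.mul (H.head s t) x.1)
    rw [strip_mul_strip, H.mul_mul h]

theorem State.act_δ_val (x : H.State) : (x.act H.δ).1 = x.1.map H.τ.symm := by
  change H.strip (H.mul H.δ x.1) = _
  rw [show H.mul H.δ x.1 = H.δ :: x.1 from x.2.1, strip_δ_cons, x.2.2]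

theorem State.act_δ_rotate (x : H.State) : x.rotate.act H.δ = x :=
  State.ext <| by
    rw [State.act_δ_val]
    change (x.1.map H.τ).map H.τ.symm = x.1
    simp

theorem State.rotate_act (s : S) (x : H.State) :
    (x.act s).rotate = x.rotate.act (H.τ s) :=
  State.ext <| by
    change (H.strip (H.mul s x.1)).map H.τ = H.strip (H.mul (H.τ s) (x.1.map H.τ))
    rw [mul_map, strip_map]

variable (H)

/-- Left multiplication by a simple element, as a permutation of the cosets of the powers
of `δ`. -/
def actPerm (s : S) : Equiv.Perm H.State where
  toFun x := x.act s
  -- From s · `compl s` = δ one gets s⁻¹ = `compl s` · δ⁻¹, and `rotate` is the action of δ⁻¹.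
  invFun x := x.rotate.act (H.compl s)
  left_inv x := by
    change (x.act s).rotate.act (H.compl s) = x
    rw [State.rotate_act, State.act_act (H.rest_compl_left s), H.head_compl_left,
      State.act_δ_rotate]
  right_inv x := by
    change (x.rotate.act (H.compl s)).act s = x
    rw [State.act_act (H.rest_compl s), H.head_compl, State.act_δ_rotate]

theorem actPerm_mul {s t : S} (h : H.rest s t = H.e) :
    H.actPerm s * H.actPerm t = H.actPerm (H.head s t) :=
  Equiv.ext fun x => State.act_act h x

theorem actPerm_e : H.actPerm H.e = 1 :=
  Equiv.ext fun x => State.ext <| by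
    change H.strip (H.mul H.e x.1) = x.1
    rw [mul_e, x.2.2]

/-! ### Weights on normal forms -/

/-- The total weight of a list of simple elements. -/
def weight (v : S → ℤ) (L : List S) : ℤ := (L.map v).sum

/-- `v` is a weight of simple elements that changes by at least `-d` and at most `c` if the braid
is multiplied on the left by an element of `A`. -/
structure IsWeight (A : Set S) (v : S → ℤ) (c d : ℤ) : Prop where
  v_δ : v H.δ = 0
  v_τ : ∀ s, v (H.τ s) = v s
  v_atom : ∀ a ∈ A, -d ≤ v a ∧ v a ≤ c
  e_notMem : H.e ∉ A
  -- The band is absorbed by s, or a band is carried past a factor of the same weight, or s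
  -- reappears as the carry and the head is a new factor.
  step : ∀ a ∈ A, ∀ s,
    (H.rest a s = H.e ∧ -d ≤ v (H.head a s) - v s ∧ v (H.head a s) - v s ≤ c) ∨
    (H.rest a s ∈ A ∧ v (H.head a s) = v s) ∨
    (H.rest a s = s ∧ -d ≤ v (H.head a s) ∧ v (H.head a s) ≤ c)

namespace IsWeight

variable {H} {A : Set S} {v : S → ℤ} {c d : ℤ} (hv : H.IsWeight A v c d)

include hv

omit [DecidableEq S] in
theorem v_τ_symm (s : S) : v (H.τ.symm s) = v s := by
  rw [← hv.v_τ, Equiv.apply_symm_apply]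

omit [DecidableEq S] in
theorem weight_map_symm (L : List S) : weight v (L.map H.τ.symm) = weight v L := by
  simp [weight, Function.comp_def, hv.v_τ_symm]

theorem weight_strip (L : List S) : weight v (H.strip L) = weight v L := by
  induction L with
  | nil => rfl
  | cons s L ih =>
    by_cases hs : s = H.δ
    · subst hs
      rw [strip_δ_cons, hv.weight_map_symm, ih]
      simp [weight, hv.v_δ]
    · rw [H.strip_cons hs]

/-- Only the place where the carry is absorbed, or comes to rest, changes the weight. In the last
alternative the carry is s, and normality of s :: L leaves everything after the new head untouched.
-/
theorem weight_mul {L : List S} (hL : H.IsNormal L) {a : S} (ha : a ∈ A) :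
    -d ≤ weight v (H.mul a L) - weight v L ∧ weight v (H.mul a L) - weight v L ≤ c := by
  induction L generalizing a with
  | nil =>
    have : a ≠ H.e := fun h => hv.e_notMem (h ▸ ha)
    simpa [HeadSystem.mul, this, weight] using hv.v_atom a ha
  | cons s L ih =>
    have hcons : ∀ (t : S) (L : List S), weight v (t :: L) = v t + weight v L := by
      simp [weight]
    rw [mul_cons, hcons, hcons]
    rcases hv.step a ha s with ⟨h1, h2, h3⟩ | ⟨h1, h2⟩ | ⟨h1, h2, h3⟩
    · rw [h1, mul_e]
      constructor <;> linarith
    · obtain ⟨h3, h4⟩ := ih hL.of_cons h1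
      rw [h2]
      constructor <;> linarith
    · rw [h1, isNormal_cons_iff.1 hL, hcons]
      constructor <;> linarith

theorem weight_act (x : H.State) {a : S} (ha : a ∈ A) :
    -d ≤ weight v (x.act a).1 - weight v x.1 ∧ weight v (x.act a).1 - weight v x.1 ≤ c := by
  have := hv.weight_mul x.2.1 ha
  rwa [← hv.weight_strip (H.mul a x.1)] at this

end IsWeight

end HeadSystem

/-! ### From the action to the lower bound -/

namespace BraidGroup

variable {n : ℕ} {S : Type} [DecidableEq S]

/-- A realisation of a system of simple elements by the canonical factors of the braid group. -/
structure Realization (n : ℕ) (H : HeadSystem S) where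
  ev : S → BraidGroup n
  ρ : BraidGroup n →* Equiv.Perm H.State
  atom : Band n → S
  len : S → ℕ
  ev_mul : ∀ s t, H.rest s t = H.e → ev s * ev t = ev (H.head s t)
  ev_δ : ev H.δ = delta n
  ev_atom : ∀ b, ev (atom b) = band b
  len_atom : ∀ b, len (atom b) = 1
  ρ_ev : ∀ s, ρ (ev s) = H.actPerm s
  isPositive : ∀ s, IsPositive (ev s)
  deg_ev : ∀ s, deg (ev s) = len s
  eq_e : ∀ s, len s = 0 → s = H.e
  exists_ev : ∀ A, IsCanonicalFactor A → ∃ s, ev s = A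

namespace Realization

variable {H : HeadSystem S} (R : Realization n H)

theorem ev_e : R.ev H.e = 1 := by
  have := R.ev_mul H.e H.e (H.rest_e_left _)
  rwa [H.head_e_left, mul_eq_left] at this

theorem ev_mul_compl (s : S) : R.ev s * R.ev (H.compl s) = delta n := by
  rw [R.ev_mul s _ (H.rest_compl s), H.head_compl, R.ev_δ]

theorem isCanonicalFactor (s : S) : IsCanonicalFactor (R.ev s) :=
  ⟨(R.isPositive s).one_le, 1, R.ev (H.compl s), .one, R.isPositive _, by
    rw [one_mul, R.ev_mul_compl]⟩

theorem tau_ev (s : S) : tau (R.ev s) = R.ev (H.τ s) := by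
  have : R.ev s * delta n = delta n * R.ev (H.τ s) := by
    conv_rhs => rw [← R.ev_mul_compl s]
    rw [mul_assoc, R.ev_mul _ _ (H.rest_compl_left s), H.head_compl_left, R.ev_δ]
  rw [tau, mul_assoc, this, inv_mul_cancel_left]

theorem isCanonicalFactor_tau (R : Realization n H) (A : BraidGroup n) (hA : IsCanonicalFactor A) :
    IsCanonicalFactor (tau A) := by
  obtain ⟨s, rfl⟩ := R.exists_ev A hA
  rw [R.tau_ev]
  exact R.isCanonicalFactor _

/-- `exists_factor` splits off from t the part u that greedy normalisation moves into s. Maximality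
forces u to have degree 0. -/
theorem head_eq_of_maximallyLeftWeighted {s t : S}
    (h : MaximallyLeftWeighted (R.ev s) (R.ev t)) : H.head s t = s := by
  obtain ⟨u, h1, h2, h3, h4⟩ := H.exists_factor s t
  have h5 : R.ev s * R.ev u = R.ev (H.head s t) := by rw [R.ev_mul s u h1, h2]
  have h6 : R.ev u * R.ev (H.rest s t) = R.ev t := by rw [R.ev_mul u _ h3, h4]
  have h7 := (h _ _ (R.isCanonicalFactor (H.head s t)) (R.isCanonicalFactor (H.rest s t))
    ⟨by rw [← h5, ← h6, mul_assoc], R.ev u, R.isCanonicalFactor u, h5⟩).1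
  rw [← h5, mul_eq_left] at h7
  have h8 := R.deg_ev u
  rw [h7, deg_one] at h8
  rw [← h2, R.eq_e u (by exact_mod_cast h8.symm), H.head_e_right]

theorem ρ_ev_apply_val {s : S} (hs : s ≠ H.δ) {x : H.State} (h : H.IsNormal (s :: x.1)) :
    (R.ρ (R.ev s) x).1 = s :: x.1 := by
  rw [R.ρ_ev]
  change H.strip (H.mul s x.1) = _
  rw [HeadSystem.isNormal_cons_iff.1 h, H.strip_cons hs]

/-- A normal form without δ is read off from its action on the empty form; this is what makes
weights of left-canonical forms computable from arbitrary words. -/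
theorem ρ_prod_val {L : List S} (hL : H.IsNormal L) (hδ : H.δ ∉ L) :
    (R.ρ (L.map R.ev).prod HeadSystem.State.empty).1 = L := by
  induction L with
  | nil => rw [List.map_nil, List.prod_nil, map_one]; rfl
  | cons s L ih =>
    have h1 := ih hL.of_cons fun h => hδ (List.mem_cons_of_mem _ h)
    rw [List.map_cons, List.prod_cons, map_mul, Equiv.Perm.mul_apply,
      R.ρ_ev_apply_val (by rintro rfl; simp at hδ) (by rwa [h1]), h1]

section Weight

variable {v : S → ℤ} {c d : ℤ} (hv : H.IsWeight {s | R.len s = 1} v c d)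

include hv

theorem weight_ρ_delta (x : H.State) :
    HeadSystem.weight v (R.ρ (delta n) x).1 = HeadSystem.weight v x.1 := by
  rw [← R.ev_δ, R.ρ_ev]
  change HeadSystem.weight v (x.act H.δ).1 = _
  rw [HeadSystem.State.act_δ_val, hv.weight_map_symm]

theorem weight_ρ_delta_zpow (r : ℤ) (x : H.State) :
    HeadSystem.weight v (R.ρ (delta n ^ r) x).1 = HeadSystem.weight v x.1 := by
  induction r with
  | zero => simp
  | succ k ih => rw [add_comm, zpow_one_add, map_mul, Equiv.Perm.mul_apply, R.weight_ρ_delta hv, ih]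
  | pred k ih =>
    rw [← ih, ← R.weight_ρ_delta hv (R.ρ (delta n ^ (-(k : ℤ) - 1)) x), ← Equiv.Perm.mul_apply,
      ← map_mul, ← zpow_one_add, add_sub_cancel]

/-- A positive letter raises the weight by at most c. A negative letter is the inverse of a
multiplication that lowers it by at most d, so it raises it by at most d. -/
theorem weight_ρ_eval_le (W : BandWord n) :
    HeadSystem.weight v (R.ρ W.eval HeadSystem.State.empty).1 ≤
      c * (W.length - W.nb) + d * W.nb := by
  induction W with
  | nil =>
    rw [BandWord.eval_nil, map_one]
    change HeadSystem.weight v [] ≤ _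
    simp [HeadSystem.weight]
  | cons x W ih =>
    obtain ⟨b, _ | _⟩ := x
    · have h1 := (hv.weight_act (R.ρ (BandWord.eval ((b, false) :: W)) HeadSystem.State.empty)
        (R.len_atom b)).1
      have h2 : (R.ρ (BandWord.eval ((b, false) :: W)) HeadSystem.State.empty).act (R.atom b) =
          R.ρ (BandWord.eval W) HeadSystem.State.empty := by
        change H.actPerm (R.atom b) _ = _
        rw [← R.ρ_ev, R.ev_atom, ← Equiv.Perm.mul_apply, ← map_mul, BandWord.eval_cons]
        simp
      rw [h2] at h1
      have h3 : BandWord.nb ((b, false) :: W) = BandWord.nb W + 1 := by simp [BandWord.nb]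
      rw [h3, List.length_cons]
      push_cast
      linarith
    · have h1 := (hv.weight_act (R.ρ (BandWord.eval W) HeadSystem.State.empty) (R.len_atom b)).2
      have h2 : (R.ρ (BandWord.eval W) HeadSystem.State.empty).act (R.atom b) =
          R.ρ (BandWord.eval ((b, true) :: W)) HeadSystem.State.empty := by
        change H.actPerm (R.atom b) _ = _
        rw [← R.ρ_ev, R.ev_atom, ← Equiv.Perm.mul_apply, ← map_mul, BandWord.eval_cons]
        simp
      rw [h2] at h1
      have h3 : BandWord.nb ((b, true) :: W) = BandWord.nb W := by simp [BandWord.nb]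
      rw [h3, List.length_cons]
      push_cast
      linarith

end Weight

/-- The weight of simple elements that gives the bound `DeltaWord.defect c`. -/
def defectWeight (c : ℤ) (s : S) : ℤ :=
  c * R.len s - ((n - 1 : ℕ) : ℤ) * max 0 (c - ((n - 1 : ℕ) : ℤ) + R.len s)

theorem defect_le (hn : 2 ≤ n) {L : DeltaWord n} {W : BandWord n} (hL : IsLCF W.eval L) {c : ℤ}
    (hv : H.IsWeight {s | R.len s = 1} (R.defectWeight c) c (((n - 1 : ℕ) : ℤ) - c)) :
    L.defect c ≤ W.nb := by
  obtain ⟨r, l⟩ := L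
  obtain ⟨h1, h2, h3⟩ := hL
  simp only at h1 h2 h3
  obtain ⟨l, rfl⟩ : l ∈ Set.range (List.map R.ev) := by
    rw [Set.range_list_map]
    exact fun A hA => R.exists_ev A (h2 A hA).1
  have he : H.e ∉ l := fun h => (h2 _ (List.mem_map_of_mem h)).2.1 R.ev_e
  have hδ : H.δ ∉ l := fun h => (h2 _ (List.mem_map_of_mem h)).2.2 R.ev_δ
  have hl : H.IsNormal l := HeadSystem.isNormal_of_isChain
    (((List.isChain_map _).1 h3).imp fun _ _ => R.head_eq_of_maximallyLeftWeighted) he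
  have hw := R.weight_ρ_eval_le hv W
  rw [h1, map_mul, Equiv.Perm.mul_apply, R.weight_ρ_delta_zpow hv, R.ρ_prod_val hl hδ] at hw
  have hd := BandWord.deg_eval W
  rw [h1, deg_mul, deg_zpow, deg_delta, deg_list_prod, List.map_map] at hd
  have hN : (0 : ℤ) < ((n - 1 : ℕ) : ℤ) := by omega
  refine le_of_mul_le_mul_left ?_ hN
  -- The linear part c · len of the weight cancels against c times the exponent sum, leaving n - 1
  -- times the defect.
  have key : ((n - 1 : ℕ) : ℤ) * DeltaWord.defect c ⟨r, l.map R.ev⟩ =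
      HeadSystem.weight (R.defectWeight c) l - c * (l.map (deg ∘ R.ev)).sum
        - c * (r * ((n - 1 : ℕ) : ℤ)) := by
    simp only [DeltaWord.defect, List.map_map, HeadSystem.weight]
    clear * -
    induction l with
    | nil => simp; ring
    | cons s l ih =>
      simp only [List.map_cons, List.sum_cons, Function.comp_apply, defectWeight, R.deg_ev] at ih ⊢
      rw [max_eq_left (show -(R.len s : ℤ) ≤ 0 by omega)]
      linarith
  rw [key]
  have hd' := congrArg (c * ·) hd
  simp only [mul_add] at hd'
  linarith

end Realization

end BraidGroup

/-! ### Multiplication tables for three and four strands -/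

namespace BraidGroup

/-- The first factors of the normalised products of two canonical factors of `B_3`, which are
numbered in the order `1, a₁₂, a₂₃, a₁₃, δ`. -/
def headTable3 : List (List (Fin 5)) :=
  [
    [0, 1, 2, 3, 4],
    [1, 1, 1, 4, 4],
    [2, 4, 2, 2, 4],
    [3, 3, 4, 3, 4],
    [4, 4, 4, 4, 4]]

/-- The second factors of the normalised products of two canonical factors of `B_3`. -/
def restTable3 : List (List (Fin 5)) :=
  [
    [0, 0, 0, 0, 0],
    [0, 1, 2, 0, 2],
    [0, 0, 2, 3, 3],
    [0, 1, 0, 3, 1],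
    [0, 1, 2, 3, 4]]

/-- The canonical factors of `B_3`. -/
def headSystem3 : HeadSystem (Fin 5) where
  e := 0
  δ := 4
  head s t := (headTable3.getD s []).getD t 0
  rest s t := (restTable3.getD s []).getD t 0
  compl s := ([4, 3, 1, 2, 0] : List (Fin 5)).getD s 0
  τ :=
    { toFun := fun s => ([0, 2, 3, 1, 4] : List (Fin 5)).getD s 0
      invFun := fun s => ([0, 3, 1, 2, 4] : List (Fin 5)).getD s 0
      left_inv := by unfold Function.LeftInverse; decide
      right_inv := by unfold Function.RightInverse Function.LeftInverse; decide }
  e_ne_δ := by decide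
  head_e_left := by decide
  head_e_right := by decide
  rest_e_left := by decide
  rest_e_right := by decide
  head_δ_left := by decide
  head_δ_right := by decide
  rest_δ_left := by decide
  rest_δ_right := by decide
  eq_e_of_head := by decide
  rest_eq_of_head := by decide
  head_compl := by decide
  rest_compl := by decide
  head_compl_left := by decide
  rest_compl_left := by decide
  head_τ := by decide
  rest_τ := by decide
  head_head := by decide +kernel
  rest_rest := by decide +kernel
  head_rest := by decide +kernel
  exists_factor := by decide +kernel

/-- The first factors of the normalised products of two canonical factors of `B_4`, which are
numbered in the order `1, a₁₂, a₂₃, a₃₄, a₁₄, a₁₃, a₂₄, a₂₃a₁₂, a₃₄a₂₃, a₂₄a₁₂, a₃₄a₁₃, a₃₄a₁₂, a₂₃a₁₄, δ`. -/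
def headTable4 : List (List (Fin 14)) :=
  [
    [0, 1, 2, 3, 4, 5, 6, 7, 8, 9, 10, 11, 12, 13],
    [1, 1, 1, 11, 9, 7, 1, 7, 11, 9, 13, 11, 9, 13],
    [2, 7, 2, 2, 12, 2, 8, 7, 8, 13, 12, 7, 12, 13],
    [3, 11, 8, 3, 3, 10, 3, 13, 8, 11, 10, 11, 8, 13],
    [4, 4, 12, 10, 4, 4, 9, 12, 13, 9, 10, 10, 12, 13],
    [5, 5, 7, 5, 10, 5, 5, 7, 7, 10, 10, 5, 13, 13],
    [6, 9, 6, 8, 6, 6, 6, 9, 8, 9, 8, 13, 6, 13],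
    [7, 7, 7, 7, 13, 7, 7, 7, 7, 13, 13, 7, 13, 13],
    [8, 13, 8, 8, 8, 8, 8, 13, 8, 13, 8, 13, 8, 13],
    [9, 9, 9, 13, 9, 9, 9, 9, 13, 9, 13, 13, 9, 13],
    [10, 10, 13, 10, 10, 10, 10, 13, 13, 10, 10, 10, 13, 13],
    [11, 11, 11, 11, 11, 13, 11, 13, 11, 11, 13, 11, 11, 13],
    [12, 12, 12, 12, 12, 12, 13, 12, 13, 13, 12, 12, 12, 13],
    [13, 13, 13, 13, 13, 13, 13, 13, 13, 13, 13, 13, 13, 13]]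

/-- The second factors of the normalised products of two canonical factors of `B_4`. -/
def restTable4 : List (List (Fin 14)) :=
  [
    [0, 0, 0, 0, 0, 0, 0, 0, 0, 0, 0, 0, 0, 0],
    [0, 1, 2, 0, 0, 0, 6, 2, 2, 6, 0, 1, 2, 2],
    [0, 0, 2, 3, 0, 5, 0, 5, 3, 0, 3, 3, 2, 3],
    [0, 0, 0, 3, 4, 0, 6, 0, 6, 4, 4, 3, 4, 4],
    [0, 1, 0, 0, 4, 5, 0, 1, 0, 1, 5, 1, 4, 1],
    [0, 1, 0, 3, 0, 5, 6, 1, 6, 6, 3, 11, 0, 6],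
    [0, 0, 2, 0, 4, 5, 6, 5, 2, 4, 5, 0, 12, 5],
    [0, 1, 2, 3, 0, 5, 6, 7, 8, 6, 3, 11, 2, 8],
    [0, 0, 2, 3, 4, 5, 6, 5, 8, 4, 10, 3, 12, 10],
    [0, 1, 2, 0, 4, 5, 6, 7, 2, 9, 5, 1, 12, 7],
    [0, 1, 0, 3, 4, 5, 6, 1, 6, 9, 10, 11, 4, 9],
    [0, 1, 2, 3, 4, 0, 6, 2, 8, 9, 4, 11, 12, 12],
    [0, 1, 2, 3, 4, 5, 0, 7, 3, 1, 10, 11, 12, 11],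
    [0, 1, 2, 3, 4, 5, 6, 7, 8, 9, 10, 11, 12, 13]]

/-- The canonical factors of `B_4`. -/
def headSystem4 : HeadSystem (Fin 14) where
  e := 0
  δ := 13
  head s t := (headTable4.getD s []).getD t 0
  rest s t := (restTable4.getD s []).getD t 0
  compl s := ([13, 10, 9, 7, 8, 12, 11, 4, 1, 3, 2, 5, 6, 0] : List (Fin 14)).getD s 0
  τ :=
    { toFun := fun s => ([0, 2, 3, 4, 1, 6, 5, 8, 10, 7, 9, 12, 11, 13] : List (Fin 14)).getD s 0
      invFun := fun s => ([0, 4, 1, 2, 3, 6, 5, 9, 7, 10, 8, 12, 11, 13] : List (Fin 14)).getD s 0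
      left_inv := by unfold Function.LeftInverse; decide
      right_inv := by unfold Function.RightInverse Function.LeftInverse; decide }
  e_ne_δ := by decide
  head_e_left := by decide
  head_e_right := by decide
  rest_e_left := by decide
  rest_e_right := by decide
  head_δ_left := by decide
  head_δ_right := by decide
  rest_δ_left := by decide
  rest_δ_right := by decide
  eq_e_of_head := by decide
  rest_eq_of_head := by decide
  head_compl := by decide
  rest_compl := by decide
  head_compl_left := by decide
  rest_compl_left := by decide
  head_τ := by decide
  rest_τ := by decide
  head_head := by decide +kernel
  rest_rest := by decide +kernel
  head_rest := by decide +kernel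
  exists_factor := by decide +kernel

end BraidGroup

/-! ### Canonical factors as words in the bands -/

namespace BraidGroup

variable {n : ℕ}

theorem isPositive_prod_band (l : List (Band n)) : IsPositive (l.map band).prod := by
  induction l with
  | nil => exact .one
  | cons b l ih => rw [List.map_cons, List.prod_cons]; exact (isPositive_band b).mul ih

theorem deg_prod_band (l : List (Band n)) : deg (l.map band).prod = l.length := by
  simp [deg_list_prod, Function.comp_def]

theorem IsPositive.exists_prod_band {α : BraidGroup n} (h : IsPositive α) :
    ∃ l : List (Band n), (l.map band).prod = α := by
  obtain ⟨W, hW, rfl⟩ := h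
  refine ⟨W.map Prod.fst, ?_⟩
  rw [BandWord.eval, List.map_map]
  congr 1
  exact List.map_congr_left fun x hx => by simp [hW x hx]

theorem IsCanonicalFactor.eq_delta {A : BraidGroup n} (h : IsCanonicalFactor A)
    (hd : deg A = ((n - 1 : ℕ) : ℤ)) : A = delta n := by
  by_contra hA
  by_cases h1 : A = 1
  · rw [h1, deg_one] at hd
    refine hA (h1.trans ?_)
    have : IsPositive (delta n) := ⟨deltaWord n, isPositive_deltaWord, eval_deltaWord⟩
    exact (this.eq_one (by rw [deg_delta, ← hd])).symm
  · exact absurd hd (IsProperFactor.deg_lt ⟨h, h1, hA⟩).ne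

/-- A system of simple elements given by positive words in the bands, for which left multiplication
by a band can be carried out with the relations `rels`. -/
structure WordSystem (n : ℕ) {S : Type} [DecidableEq S] (H : HeadSystem S) where
  atom : Band n → S
  word : S → List (Band n)
  rels : List (List (Band n) × List (Band n))
  ρ : BraidGroup n →* Equiv.Perm H.State
  rels_sound : ∀ p ∈ rels, (p.1.map band).prod = (p.2.map band).prod
  word_δ : word H.δ = (deltaWord n).map Prod.fst
  word_e : word H.e = []
  word_atom : ∀ b, word (atom b) = [b]
  eq_e_or_cons : ∀ s, s = H.e ∨ ∃ b s', word s = b :: word s' ∧ H.rest (atom b) s' = H.e ∧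
    H.head (atom b) s' = s
  band_mul : ∀ b s, H.rest (atom b) s = H.e → b :: word s = word (H.head (atom b) s) ∨
    (b :: word s, word (H.head (atom b) s)) ∈ rels
  ρ_band : ∀ b, ρ (band b) = H.actPerm (atom b)

namespace WordSystem

variable {S : Type} [DecidableEq S] {H : HeadSystem S} (w : WordSystem n H)

/-- The canonical factor with a given number. -/
def ev (s : S) : BraidGroup n := ((w.word s).map band).prod

theorem ev_atom (b : Band n) : w.ev (w.atom b) = band b := by simp [ev, w.word_atom]

theorem ev_e : w.ev H.e = 1 := by simp [ev, w.word_e]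

theorem ev_δ : w.ev H.δ = delta n := by
  rw [← eval_deltaWord, ev, w.word_δ, BandWord.eval, List.map_map]
  congr 1
  exact List.map_congr_left fun x hx => by simp [isPositive_deltaWord x hx]

theorem band_mul_ev {b : Band n} {s : S} (h : H.rest (w.atom b) s = H.e) :
    band b * w.ev s = w.ev (H.head (w.atom b) s) := by
  rw [ev, ← List.prod_cons, ← List.map_cons]
  rcases w.band_mul b s h with h | h
  · rw [h, ev]
  · exact w.rels_sound _ h

theorem cons_induction {P : S → Prop} (he : P H.e)
    (hcons : ∀ b s, H.rest (w.atom b) s = H.e → P s → P (H.head (w.atom b) s)) (s : S) : P s := by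
  generalize hk : (w.word s).length = k
  induction k generalizing s with
  | zero =>
    rcases w.eq_e_or_cons s with rfl | ⟨b, t, h, -, -⟩
    · exact he
    · simp [h] at hk
  | succ k ih =>
    rcases w.eq_e_or_cons s with rfl | ⟨b, t, h, h1, rfl⟩
    · exact he
    · exact hcons b t h1 (ih t (by simpa [h] using hk))

/-- Peel bands off the left factor: `head_rest` and `eq_e_of_head` show that if (b s) t is simple,
then so are s t and b (s t). Only products by a single band need relations. -/
theorem ev_mul (s t : S) (h : H.rest s t = H.e) : w.ev s * w.ev t = w.ev (H.head s t) := by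
  induction s using w.cons_induction with
  | he => rw [H.head_e_left, w.ev_e, one_mul]
  | hcons b s hbs ih =>
    have h1 := H.head_rest _ _ hbs t
    rw [h] at h1
    have h2 := H.eq_e_of_head _ _ h1
    rw [h2, H.head_e_right] at h1
    rw [← w.band_mul_ev hbs, mul_assoc, ih h2, w.band_mul_ev h1, H.head_head _ _ hbs]

theorem ρ_ev (s : S) : w.ρ (w.ev s) = H.actPerm s := by
  induction s using w.cons_induction with
  | he => rw [w.ev_e, map_one, H.actPerm_e]
  | hcons b s hbs ih => rw [← w.band_mul_ev hbs, map_mul, ih, w.ρ_band, H.actPerm_mul hbs]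

/-- In degrees 0, 1 and n - 1 a canonical factor is 1, a band or δ. For n ≤ 4 this leaves only
degree 2 in B_4. -/
theorem exists_ev_of_deg_eq_two (hn : n ≤ 4) {A : BraidGroup n} (hA : IsCanonicalFactor A)
    (h2 : deg A = 2 → n = 4 → ∃ s, w.ev s = A) : ∃ s, w.ev s = A := by
  obtain ⟨l, rfl⟩ := hA.isPositive.exists_prod_band
  have hle := hA.deg_le
  have hδ := hA.eq_delta
  simp only [deg_prod_band] at hle hδ h2
  match l with
  | [] => exact ⟨H.e, w.ev_e⟩
  | [b] => exact ⟨w.atom b, by simp [w.ev_atom]⟩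
  | [b, c] =>
    by_cases h4 : n = 4
    · exact h2 (by simp) h4
    · refine ⟨H.δ, w.ev_δ.trans (hδ ?_).symm⟩
      simp only [List.length_cons, List.length_nil] at hle ⊢
      omega
  | b :: c :: d :: l =>
    refine ⟨H.δ, w.ev_δ.trans (hδ ?_).symm⟩
    simp only [List.length_cons] at hle ⊢
    omega

/-- The canonical factors of the braid group form a realisation if every one of them occurs. -/
def realization (hw : ∀ A, IsCanonicalFactor A → ∃ s, w.ev s = A) : Realization n H where
  ev := w.ev
  ρ := w.ρ
  atom := w.atom
  len s := (w.word s).length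
  ev_mul := w.ev_mul
  ev_δ := w.ev_δ
  ev_atom := w.ev_atom
  len_atom b := by simp [w.word_atom]
  ρ_ev := w.ρ_ev
  isPositive s := isPositive_prod_band _
  deg_ev s := deg_prod_band _
  eq_e s hs := by
    rcases w.eq_e_or_cons s with h | ⟨b, t, h, -, -⟩
    · exact h
    · simp [h] at hs
  exists_ev := hw

/-- δ fixes the empty form, which gives a decidable necessary condition for three bands to multiply
to δ. -/
theorem strip_mul_eq_nil_of_delta_eq {b c d : Band n} (h : band b * band c * band d = delta n) :
    H.strip (H.mul (w.atom b) (H.strip (H.mul (w.atom c)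
      (H.strip (H.mul (w.atom d) []))))) = [] := by
  have h1 : (w.ρ (delta n) HeadSystem.State.empty).1 = [] := by
    rw [← w.ev_δ, w.ρ_ev]
    exact HeadSystem.State.act_δ_val _
  rw [← h, map_mul, map_mul, w.ρ_band, w.ρ_band, w.ρ_band] at h1
  exact h1

/-- A factor b c of degree 2 in B_4 misses δ by a single band d, so b c d = δ or d b c = δ. The
finitely many such triples are tested by the action, and in each the adjacent pairs have simple
products. -/
theorem exists_ev (hn : n ≤ 4) (hatoms : ∀ b c d : Band n,
      H.strip (H.mul (w.atom b) (H.strip (H.mul (w.atom c)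
        (H.strip (H.mul (w.atom d) []))))) = [] →
      H.rest (w.atom b) (w.atom c) = H.e ∧ H.rest (w.atom c) (w.atom d) = H.e)
    (A : BraidGroup n) (hA : IsCanonicalFactor A) : ∃ s, w.ev s = A := by
  refine w.exists_ev_of_deg_eq_two hn hA fun h2 h4 => ?_
  obtain ⟨P, Q, hP, hQ, hδ⟩ := hA.2
  obtain ⟨l, rfl⟩ := hA.isPositive.exists_prod_band
  obtain ⟨p, rfl⟩ := hP.exists_prod_band
  obtain ⟨q, rfl⟩ := hQ.exists_prod_band
  have hdeg := congrArg deg hδ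
  simp only [deg_mul, deg_prod_band, deg_delta] at h2 hdeg
  obtain ⟨b, c, rfl⟩ := List.length_eq_two.1 (show l.length = 2 by omega)
  have hrest : H.rest (w.atom b) (w.atom c) = H.e := by
    rcases p with _ | ⟨d, p⟩
    · obtain ⟨d, rfl⟩ := List.length_eq_one_iff.1
        (show q.length = 1 by simp only [List.length_cons, List.length_nil] at hdeg; omega)
      refine (hatoms b c d (w.strip_mul_eq_nil_of_delta_eq ?_)).1
      rw [hδ]; simp
    · simp only [List.length_cons, List.length_nil] at hdeg
      obtain rfl := List.length_eq_zero_iff.1 (show p.length = 0 by omega)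
      obtain rfl := List.length_eq_zero_iff.1 (show q.length = 0 by omega)
      refine (hatoms d b c (w.strip_mul_eq_nil_of_delta_eq ?_)).2
      rw [hδ]; simp [mul_assoc]
  refine ⟨H.head (w.atom b) (w.atom c), ?_⟩
  rw [← w.ev_mul _ _ hrest, w.ev_atom, w.ev_atom]
  simp

end WordSystem

/-! ### Relations between bands -/

section Relations

variable {G : Type*} [Group G]

/-- With x = q p q⁻¹, the braid relation for p, q is equivalent to the triangle relation x q = q p =
p x; the next lemma is the converse. -/
theorem mul_conj_of_braid {p q x : G} (h : p * q * p = q * p * q) (hx : x * q = q * p) :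
    p * x = q * p := by
  rw [eq_mul_inv_of_mul_eq hx, ← mul_assoc, ← mul_assoc, h, mul_inv_cancel_right]

theorem braid_of_mul_eq {p q x : G} (hx : x * q = q * p) (hp : p * x = q * p) :
    p * q * p = q * p * q := by
  rw [← hp, mul_assoc, mul_assoc, hx]

end Relations

theorem sigma_braid {i j : Fin (n - 1)} (h : (i : ℕ) + 1 = j) :
    (sigma i * sigma j * sigma i : BraidGroup n) = sigma j * sigma i * sigma j := by
  rw [← mul_inv_eq_one]
  have := PresentedGroup.one_of_mem (rels := braidRels n)
    (x := (FreeGroup.of i * FreeGroup.of j * FreeGroup.of i) *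
        (FreeGroup.of j * FreeGroup.of i * FreeGroup.of j)⁻¹) (.inr ⟨i, j, h, rfl⟩)
  simpa [sigma, PresentedGroup.of] using this

theorem sigma_comm {i j : Fin (n - 1)} (h : (i : ℕ) + 1 < j) :
    (sigma i * sigma j : BraidGroup n) = sigma j * sigma i := by
  rw [← mul_inv_eq_one]
  have := PresentedGroup.one_of_mem (rels := braidRels n)
    (x := (FreeGroup.of i * FreeGroup.of j) * (FreeGroup.of j * FreeGroup.of i)⁻¹)
    (.inl ⟨i, j, h, rfl⟩)
  simpa [sigma, PresentedGroup.of] using this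

/-- The band with end strands `i` and `j`. -/
abbrev bandIndex (i j : Fin n) (h : i < j := by decide) : Band n := ⟨(i, j), h⟩

theorem band_of_descending {i j : Fin n} (h : i < j) {l : List (Fin (n - 1))} (k : Fin (n - 1))
    (hk : (k : ℕ) = i)
    (hl : (List.finRange (n - 1)).reverse.filter
      (fun k : Fin (n - 1) => decide ((i : ℕ) < (k : ℕ) ∧ (k : ℕ) < (j : ℕ))) = l) :
    band (bandIndex i j h) * (l.map sigma).prod = (l.map sigma).prod * sigma k := by
  have hk' : k = ⟨(i : ℕ), by omega⟩ := Fin.ext hk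
  simp only [band, descending, hl, hk', inv_mul_cancel_right]

end BraidGroup

namespace BraidGroup

/-! ### The braid groups on three and four strands -/

/-- Positive words in the bands for the canonical factors of `B_3`. -/
def words3 : List (List (Band 3)) :=
  [[], [bandIndex 0 1], [bandIndex 1 2], [bandIndex 0 2], [bandIndex 1 2, bandIndex 0 1]]

/-- The numbers of the bands among the canonical factors of `B_3`. -/
def atom3 (b : Band 3) : Fin 5 :=
  (([[0, 1, 3], [0, 0, 2]] : List (List (Fin 5))).getD b.1.1 []).getD b.1.2 0

/-- The relations between bands that are used to multiply a canonical factor of `B_3` by a band. -/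
def rels3 : List (List (Band 3) × List (Band 3)) :=
  [([bandIndex 0 2, bandIndex 1 2], [bandIndex 1 2, bandIndex 0 1]),
    ([bandIndex 0 1, bandIndex 0 2], [bandIndex 1 2, bandIndex 0 1])]

theorem rels3_sound : ∀ p ∈ rels3, (p.1.map band).prod = (p.2.map band).prod := by
  have hp : band (bandIndex 0 1) = (sigma 0 : BraidGroup 3) := band_succ 0 (by decide)
  have hq : band (bandIndex 1 2) = (sigma 1 : BraidGroup 3) := band_succ 1 (by decide)
  have hpq := sigma_braid (n := 3) (i := 0) (j := 1) rfl
  have hx := band_of_descending (n := 3) (i := 0) (j := 2) (by decide) (l := [1]) 0 rfl (by decide)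
  simp only [List.map_cons, List.map_nil, List.prod_cons, List.prod_nil, mul_one] at hx
  simp only [rels3, List.forall_mem_cons, List.map_cons, List.map_nil, List.prod_cons,
    List.prod_nil, mul_one, hp, hq]
  exact ⟨hx, mul_conj_of_braid hpq hx, by simp⟩

/-- The action of `B_3` on normal forms modulo powers of `δ`. -/
def action3 : BraidGroup 3 →* Equiv.Perm headSystem3.State :=
  PresentedGroup.toGroup (f := fun k : Fin 2 => headSystem3.actPerm (![1, 2] k)) (by
    have h : headSystem3.actPerm 1 * headSystem3.actPerm 2 * headSystem3.actPerm 1 =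
        headSystem3.actPerm 2 * headSystem3.actPerm 1 * headSystem3.actPerm 2 := by
      -- The factor numbered 3 is a₁₃, and a₁₃ a₂₃ = a₂₃ a₁₂ = a₁₂ a₁₃ can be read off the tables.
      refine braid_of_mul_eq (x := headSystem3.actPerm 3) ?_ ?_ <;>
        rw [headSystem3.actPerm_mul (by decide), headSystem3.actPerm_mul (by decide)] <;> rfl
    have h1 : ∀ i j : Fin 2, ¬(i : ℕ) + 1 < j := by decide
    have h2 : ∀ i j : Fin 2, (i : ℕ) + 1 = j → i = 0 ∧ j = 1 := by decide
    rintro w (⟨i, j, hij, rfl⟩ | ⟨i, j, hij, rfl⟩)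
    · exact absurd hij (h1 i j)
    · obtain ⟨rfl, rfl⟩ := h2 i j hij
      rw [map_mul, map_inv, mul_inv_eq_one]
      simpa using h)

theorem action3_band (b : Band 3) : action3 (band b) = headSystem3.actPerm (atom3 b) := by
  have hp : action3 (band (bandIndex 0 1)) = headSystem3.actPerm 1 := by
    rw [show band (bandIndex 0 1) = (sigma 0 : BraidGroup 3) from band_succ 0 (by decide)]
    exact PresentedGroup.toGroup.of _
  have hq : action3 (band (bandIndex 1 2)) = headSystem3.actPerm 2 := by
    rw [show band (bandIndex 1 2) = (sigma 1 : BraidGroup 3) from band_succ 1 (by decide)]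
    exact PresentedGroup.toGroup.of _
  have hx : action3 (band (bandIndex 0 2)) = headSystem3.actPerm 3 := by
    -- The relation a₁₃ a₂₃ = a₂₃ a₁₂ determines the action of a₁₃ from those of the Artin
    -- generators.
    have h := congrArg action3 (rels3_sound _ (.head _))
    simp only [List.map_cons, List.map_nil, List.prod_cons, List.prod_nil, mul_one, map_mul,
      hp, hq] at h
    rw [← mul_left_inj, h, headSystem3.actPerm_mul (by decide), headSystem3.actPerm_mul (by decide)]
    rfl
  have hb : ∀ b : Band 3, b = bandIndex 0 1 ∨ b = bandIndex 1 2 ∨ b = bandIndex 0 2 := by decide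
  rcases hb b with rfl | rfl | rfl
  exacts [hp, hq, hx]

/-- The canonical factors of `B_3` as positive words in the bands. -/
def wordSystem3 : WordSystem 3 headSystem3 where
  atom := atom3
  word s := words3.getD s []
  rels := rels3
  ρ := action3
  rels_sound := rels3_sound
  word_δ := by decide
  word_e := by decide
  word_atom := by decide
  eq_e_or_cons := by decide
  band_mul := by decide
  ρ_band := action3_band

/-- The realisation of the canonical factors of `B_3`. -/
def realization3 : Realization 3 headSystem3 :=
  wordSystem3.realization (wordSystem3.exists_ev (by decide) (by decide))

/-- The weight depends only on the length and is a tent with slopes c and c - 2, so absorbing a band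
changes it by one of these. -/
theorem isWeight3 {c : ℤ} (h0 : 0 ≤ c) (h2 : c ≤ 2) :
    headSystem3.IsWeight {s | realization3.len s = 1} (realization3.defectWeight c) c (2 - c) := by
  interval_cases c <;> exact
    { v_δ := by decide
      v_τ := by decide
      v_atom := by simp only [Set.mem_ofPred_eq]; decide
      e_notMem := by simp only [Set.mem_ofPred_eq]; decide
      step := by simp only [Set.mem_ofPred_eq]; decide }

/-- Positive words in the bands for the canonical factors of `B_4`. -/
def words4 : List (List (Band 4)) :=
  [[], [bandIndex 0 1], [bandIndex 1 2], [bandIndex 2 3], [bandIndex 0 3], [bandIndex 0 2],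
    [bandIndex 1 3], [bandIndex 1 2, bandIndex 0 1], [bandIndex 2 3, bandIndex 1 2],
    [bandIndex 1 3, bandIndex 0 1], [bandIndex 2 3, bandIndex 0 2],
    [bandIndex 2 3, bandIndex 0 1], [bandIndex 1 2, bandIndex 0 3],
    [bandIndex 2 3, bandIndex 1 2, bandIndex 0 1]]

/-- The numbers of the bands among the canonical factors of `B_4`. -/
def atom4 (b : Band 4) : Fin 14 :=
  (([[0, 1, 5, 4], [0, 0, 2, 6], [0, 0, 0, 3]] : List (List (Fin 14))).getD b.1.1 []).getD b.1.2 0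

/-- The relations between bands that are used to multiply a canonical factor of `B_4` by a band. -/
def rels4 : List (List (Band 4) × List (Band 4)) :=
  [([bandIndex 0 2, bandIndex 1 2], [bandIndex 1 2, bandIndex 0 1]),
    ([bandIndex 1 3, bandIndex 2 3], [bandIndex 2 3, bandIndex 1 2]),
    ([bandIndex 0 3, bandIndex 2 3], [bandIndex 2 3, bandIndex 0 2]),
    ([bandIndex 0 1, bandIndex 0 2], [bandIndex 1 2, bandIndex 0 1]),
    ([bandIndex 1 2, bandIndex 1 3], [bandIndex 2 3, bandIndex 1 2]),
    ([bandIndex 0 2, bandIndex 0 3], [bandIndex 2 3, bandIndex 0 2]),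
    ([bandIndex 0 3, bandIndex 1 3], [bandIndex 1 3, bandIndex 0 1]),
    ([bandIndex 0 1, bandIndex 0 3], [bandIndex 1 3, bandIndex 0 1]),
    ([bandIndex 0 1, bandIndex 2 3], [bandIndex 2 3, bandIndex 0 1]),
    ([bandIndex 0 3, bandIndex 1 2], [bandIndex 1 2, bandIndex 0 3]),
    ([bandIndex 0 1, bandIndex 2 3, bandIndex 0 2],
      [bandIndex 2 3, bandIndex 1 2, bandIndex 0 1]),
    ([bandIndex 1 2, bandIndex 1 3, bandIndex 0 1],
      [bandIndex 2 3, bandIndex 1 2, bandIndex 0 1]),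
    ([bandIndex 0 3, bandIndex 2 3, bandIndex 1 2],
      [bandIndex 2 3, bandIndex 1 2, bandIndex 0 1]),
    ([bandIndex 0 2, bandIndex 1 2, bandIndex 0 3],
      [bandIndex 2 3, bandIndex 1 2, bandIndex 0 1]),
    ([bandIndex 1 3, bandIndex 2 3, bandIndex 0 1],
      [bandIndex 2 3, bandIndex 1 2, bandIndex 0 1])]

theorem rels4_sound : ∀ p ∈ rels4, (p.1.map band).prod = (p.2.map band).prod := by
  have hp : band (bandIndex 0 1) = (sigma 0 : BraidGroup 4) := band_succ 0 (by decide)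
  have hq : band (bandIndex 1 2) = (sigma 1 : BraidGroup 4) := band_succ 1 (by decide)
  have hr : band (bandIndex 2 3) = (sigma 2 : BraidGroup 4) := band_succ 2 (by decide)
  have hpq := sigma_braid (n := 4) (i := 0) (j := 1) rfl
  have hqr := sigma_braid (n := 4) (i := 1) (j := 2) rfl
  have hpr := sigma_comm (n := 4) (i := 0) (j := 2) (by decide)
  have hx := band_of_descending (n := 4) (i := 0) (j := 2) (by decide) (l := [1]) 0 rfl (by decide)
  have hy := band_of_descending (n := 4) (i := 1) (j := 3) (by decide) (l := [2]) 1 rfl (by decide)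
  have hs := band_of_descending (n := 4) (i := 0) (j := 3) (by decide) (l := [2, 1]) 0 rfl
    (by decide)
  simp only [List.map_cons, List.map_nil, List.prod_cons, List.prod_nil, mul_one] at hx hy hs
  simp only [rels4, List.forall_mem_cons, List.map_cons, List.map_nil, List.prod_cons,
    List.prod_nil, mul_one, hp, hq, hr]
  -- In one-based numbering x, y, s are a₁₃, a₂₄, a₁₄, and p, q, r below are σ₁, σ₂, σ₃.
  generalize band (bandIndex (0 : Fin 4) 2) = x at *
  generalize band (bandIndex (1 : Fin 4) 3) = y at *
  generalize band (bandIndex (0 : Fin 4) 3) = s at *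
  clear hp hq hr
  generalize (sigma 0 : BraidGroup 4) = p at *
  generalize (sigma 1 : BraidGroup 4) = q at *
  generalize (sigma 2 : BraidGroup 4) = r at *
  have hpx : p * x = q * p := mul_conj_of_braid hpq hx
  have hqy : q * y = r * q := mul_conj_of_braid hqr hy
  have hsr : s * r = r * x := by
    rw [← mul_left_inj q, mul_assoc, hs, mul_assoc, mul_assoc, hx]
  -- Conjugation by p fixes r and takes q to x, so it carries over the braid relation of q and r.
  have hxr : x * r * x = r * x * r := by
    have hx' : x = p⁻¹ * q * p := by rw [mul_assoc, ← hpx, inv_mul_cancel_left]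
    have hr' : r = p⁻¹ * r * p := by rw [mul_assoc, ← hpr, inv_mul_cancel_left]
    calc x * r * x = (p⁻¹ * q * p) * (p⁻¹ * r * p) * (p⁻¹ * q * p) := by rw [← hx', ← hr']
      _ = p⁻¹ * (q * r * q) * p := by group
      _ = (p⁻¹ * r * p) * (p⁻¹ * q * p) * (p⁻¹ * r * p) := by rw [hqr]; group
      _ = r * x * r := by rw [← hx', ← hr']
  have hxs : x * s = r * x := mul_conj_of_braid hxr hsr
  -- Likewise conjugation by r fixes p and takes q to y.
  have hpy : p * y * p = y * p * y := by
    have hy' : y = r * q * r⁻¹ := eq_mul_inv_of_mul_eq hy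
    have hp' : p = r * p * r⁻¹ := eq_mul_inv_of_mul_eq hpr
    calc p * y * p = (r * p * r⁻¹) * (r * q * r⁻¹) * (r * p * r⁻¹) := by rw [← hy', ← hp']
      _ = r * (p * q * p) * r⁻¹ := by group
      _ = (r * q * r⁻¹) * (r * p * r⁻¹) * (r * q * r⁻¹) := by rw [hpq]; group
      _ = y * p * y := by rw [← hy', ← hp']
  have hsy : s * y = y * p := by
    rw [← mul_left_inj r, mul_assoc s, hy, hs, mul_assoc y, hpr, ← mul_assoc y, hy]
  have hps : p * s = y * p := mul_conj_of_braid hpy hsy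
  have hsq : s * q = q * s := by
    rw [← mul_left_inj y, mul_assoc, hqy, hs, mul_assoc q, hsy, ← mul_assoc, hqy]
  refine ⟨hx, hy, hsr, hpx, hqy, hxs, hsy, hps, hpr, hsq, ?_, ?_, ?_, ?_, ?_, by simp⟩
  · rw [← mul_assoc, hpr, mul_assoc, hpx]
  · rw [← mul_assoc, hqy, mul_assoc]
  · rw [hs, mul_assoc]
  · rw [← mul_assoc, hx, mul_assoc, hps, ← mul_assoc, hqy, mul_assoc]
  · rw [← mul_assoc, hy, mul_assoc]

/-- The action of `B_4` on normal forms modulo powers of `δ`. -/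
def action4 : BraidGroup 4 →* Equiv.Perm headSystem4.State :=
  PresentedGroup.toGroup (f := fun k : Fin 3 => headSystem4.actPerm (![1, 2, 3] k)) (by
    have hpq : headSystem4.actPerm 1 * headSystem4.actPerm 2 * headSystem4.actPerm 1 =
        headSystem4.actPerm 2 * headSystem4.actPerm 1 * headSystem4.actPerm 2 := by
      refine braid_of_mul_eq (x := headSystem4.actPerm 5) ?_ ?_ <;>
        rw [headSystem4.actPerm_mul (by decide), headSystem4.actPerm_mul (by decide)] <;> rfl
    have hqr : headSystem4.actPerm 2 * headSystem4.actPerm 3 * headSystem4.actPerm 2 =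
        headSystem4.actPerm 3 * headSystem4.actPerm 2 * headSystem4.actPerm 3 := by
      refine braid_of_mul_eq (x := headSystem4.actPerm 6) ?_ ?_ <;>
        rw [headSystem4.actPerm_mul (by decide), headSystem4.actPerm_mul (by decide)] <;> rfl
    have hpr : headSystem4.actPerm 1 * headSystem4.actPerm 3 =
        headSystem4.actPerm 3 * headSystem4.actPerm 1 := by
      rw [headSystem4.actPerm_mul (by decide), headSystem4.actPerm_mul (by decide)]
      rfl
    have h1 : ∀ i j : Fin 3, (i : ℕ) + 1 < j → i = 0 ∧ j = 2 := by decide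
    have h2 : ∀ i j : Fin 3, (i : ℕ) + 1 = j → i = 0 ∧ j = 1 ∨ i = 1 ∧ j = 2 := by decide
    rintro w (⟨i, j, hij, rfl⟩ | ⟨i, j, hij, rfl⟩)
    · obtain ⟨rfl, rfl⟩ := h1 i j hij
      rw [map_mul, map_inv, mul_inv_eq_one]
      simpa using hpr
    · obtain ⟨rfl, rfl⟩ | ⟨rfl, rfl⟩ := h2 i j hij
      · rw [map_mul, map_inv, mul_inv_eq_one]
        simpa using hpq
      · rw [map_mul, map_inv, mul_inv_eq_one]
        simpa using hqr)

theorem action4_band (b : Band 4) : action4 (band b) = headSystem4.actPerm (atom4 b) := by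
  have hp : action4 (band (bandIndex 0 1)) = headSystem4.actPerm 1 := by
    rw [show band (bandIndex 0 1) = (sigma 0 : BraidGroup 4) from band_succ 0 (by decide)]
    exact PresentedGroup.toGroup.of _
  have hq : action4 (band (bandIndex 1 2)) = headSystem4.actPerm 2 := by
    rw [show band (bandIndex 1 2) = (sigma 1 : BraidGroup 4) from band_succ 1 (by decide)]
    exact PresentedGroup.toGroup.of _
  have hr : action4 (band (bandIndex 2 3)) = headSystem4.actPerm 3 := by
    rw [show band (bandIndex 2 3) = (sigma 2 : BraidGroup 4) from band_succ 2 (by decide)]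
    exact PresentedGroup.toGroup.of _
  have hx : action4 (band (bandIndex 0 2)) = headSystem4.actPerm 5 := by
    have h := congrArg action4 (rels4_sound _ (.head _))
    simp only [List.map_cons, List.map_nil, List.prod_cons, List.prod_nil, mul_one, map_mul,
      hp, hq] at h
    rw [← mul_left_inj, h, headSystem4.actPerm_mul (by decide), headSystem4.actPerm_mul (by decide)]
    rfl
  have hy : action4 (band (bandIndex 1 3)) = headSystem4.actPerm 6 := by
    have h := congrArg action4 (rels4_sound _ (.tail _ (.head _)))
    simp only [List.map_cons, List.map_nil, List.prod_cons, List.prod_nil, mul_one, map_mul,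
      hq, hr] at h
    rw [← mul_left_inj, h, headSystem4.actPerm_mul (by decide), headSystem4.actPerm_mul (by decide)]
    rfl
  have hs : action4 (band (bandIndex 0 3)) = headSystem4.actPerm 4 := by
    have h := congrArg action4 (rels4_sound _ (.tail _ (.tail _ (.head _))))
    simp only [List.map_cons, List.map_nil, List.prod_cons, List.prod_nil, mul_one, map_mul,
      hr, hx] at h
    rw [← mul_left_inj, h, headSystem4.actPerm_mul (by decide), headSystem4.actPerm_mul (by decide)]
    rfl
  have hb : ∀ b : Band 4, b = bandIndex 0 1 ∨ b = bandIndex 1 2 ∨ b = bandIndex 2 3 ∨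
      b = bandIndex 0 2 ∨ b = bandIndex 1 3 ∨ b = bandIndex 0 3 := by decide
  rcases hb b with rfl | rfl | rfl | rfl | rfl | rfl
  exacts [hp, hq, hr, hx, hy, hs]

/-- The canonical factors of `B_4` as positive words in the bands. -/
def wordSystem4 : WordSystem 4 headSystem4 where
  atom := atom4
  word s := words4.getD s []
  rels := rels4
  ρ := action4
  rels_sound := rels4_sound
  word_δ := by decide
  word_e := by decide
  word_atom := by decide
  eq_e_or_cons := by decide +kernel
  band_mul := by decide +kernel
  ρ_band := action4_band

/-- The realisation of the canonical factors of `B_4`. -/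
def realization4 : Realization 4 headSystem4 :=
  wordSystem4.realization (wordSystem4.exists_ev (by decide) (by decide +kernel))

/-- Lengths force the three alternatives. A head of length 1 is the band itself and leaves s; if s
has length 2, a head of length 2 leaves a band, and a head of length 3 is the whole product. If s =
δ, the carry is the band τ(a). -/
theorem isWeight4 {c : ℤ} (h0 : 0 ≤ c) (h3 : c ≤ 3) :
    headSystem4.IsWeight {s | realization4.len s = 1} (realization4.defectWeight c) c (3 - c) := by
  interval_cases c <;> exact
    { v_δ := by decide +kernel
      v_τ := by decide +kernel
      v_atom := by simp only [Set.mem_ofPred_eq]; decide +kernel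
      e_notMem := by simp only [Set.mem_ofPred_eq]; decide +kernel
      step := by simp only [Set.mem_ofPred_eq]; decide +kernel }

/-! ### At most two strands -/

/-- Without proper canonical factors a left-canonical form is a power of `δ`. -/
theorem defect_le_of_le_two {n : ℕ} (hn : n ≤ 2) {L : DeltaWord n} {W : BandWord n}
    (hL : IsLCF W.eval L) {c : ℤ} (h0 : 0 ≤ c) (hc : c ≤ ((n - 1 : ℕ) : ℤ)) :
    L.defect c ≤ W.nb := by
  obtain ⟨r, l⟩ := L
  obtain ⟨h1, h2, -⟩ := hL
  have hl : l = [] := List.eq_nil_iff_forall_not_mem.2 fun A hA => by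
    have := (h2 A hA).deg_pos
    have := (h2 A hA).deg_lt
    omega
  subst hl
  have hd := BandWord.deg_eval W
  rw [h1] at hd
  simp only [List.prod_nil, mul_one, deg_zpow, deg_delta] at hd
  simp only [DeltaWord.defect, List.map_nil, List.sum_nil]
  -- Truncated subtraction puts n = 0 together with n = 1.
  obtain h | h : ((n - 1 : ℕ) : ℤ) = 0 ∨ ((n - 1 : ℕ) : ℤ) = 1 := by omega
  · obtain rfl : c = 0 := by omega
    simp
  · rw [h] at hd
    obtain rfl | rfl : c = 0 ∨ c = 1 := by omega
    · simp
    · have : W.nb ≤ W.length := List.countP_le_length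
      omega

/-- The only possible degrees are 0 and n - 1, so A is 1 or δ and commutes with δ. -/
theorem isCanonicalFactor_tau_of_le_two {n : ℕ} (hn : n ≤ 2) (A : BraidGroup n)
    (hA : IsCanonicalFactor A) : IsCanonicalFactor (tau A) := by
  suffices h : tau A = A by rwa [h]
  have h0 := hA.deg_nonneg
  have h1 := hA.deg_le
  by_cases h : deg A = ((n - 1 : ℕ) : ℤ)
  · simp [tau, hA.eq_delta h]
  · simp [tau, hA.isPositive.eq_one (by omega)]

end BraidGroup

theorem corollary5p2 (n : ℕ) (hn : n ≤ 4) (β : BraidGroup n) (W : BraidGroup.BandWord n)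
    (hW : BraidGroup.IsReducedWordOfLCF β W) :
    W.Represents β ∧ W.nb = BraidGroup.nb β := by
  obtain h | rfl | rfl : n ≤ 2 ∨ n = 3 ∨ n = 4 := by omega
  · exact BraidGroup.represents_and_nb_eq (BraidGroup.isCanonicalFactor_tau_of_le_two h)
      (fun _ _ hL _ h0 hc => BraidGroup.defect_le_of_le_two h hL h0 hc) hW
  · exact BraidGroup.represents_and_nb_eq BraidGroup.realization3.isCanonicalFactor_tau
      (fun _ _ hL _ h0 hc => BraidGroup.realization3.defect_le (by decide) hL
        (BraidGroup.isWeight3 h0 hc)) hW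
  · exact BraidGroup.represents_and_nb_eq BraidGroup.realization4.isCanonicalFactor_tau
      (fun _ _ hL _ h0 hc => BraidGroup.realization4.defect_le (by decide) hL
        (BraidGroup.isWeight4 h0 hc)) hW
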